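/- **Conventions.** $T_xf(t)=f(t-x)$, $M_\xi f(t)=e^{2\pi i\xi\cdot t}f(t)$, $\mathcal Ff(\xi)=\int f(x)e^{-2\pi i x\cdot\xi}\,dx$, each extended to $\mathcal S'(\mathbb R^n)$ by duality. A *TMIB* on $\mathbb R^n$ is a complex Banach space $E$ with dense continuous inclusions $\mathcal S(\mathbb R^n)\hookrightarrow E\hookrightarrow\mathcal S'(\mathbb R^n)$ such that $T_xE\subseteq E$, $M_\xi E\subseteq E$ and $\|T_x\|_{\mathcal L(E)}\le C_0(1+|x|)^{\tau_0}$, $\|M_\xi\|_{\mathcal L(E)}\le C_1(1+|\xi|)^{\tau_1}$ for all $x,\xi\in\mathbb R^n$ and some constants $C_j,\tau_j>0$. A *DTMIB* is the strong dual of a TMIB, regarded as a subspace of $\mathcal S'(\mathbb R^n)$. A TMIB or DTMIB $E$ is *solid* if $E\subset L^1_{\mathrm{loc}}(\mathbb R^n)$ continuously and, whenever $f\in E$, $g\in L^1_{\mathrm{loc}}(\mathbb R^n)$ and $|g|\le|f|$ a.e., then $g\in E$ and $\|g\|_E\le\|f\|_E$. Let $\Lambda\subset\mathbb R^n$ be a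 lattice, $\Lambda^\perp=\{\mu\in\mathbb R^n : \lambda\cdot\mu\in\mathbb Z\ \forall\lambda\in\Lambda\}$, let $I$ be the half-open parallelepiped $\{\sum_i t_ib_i: t_i\in[0,1)\}$ of a $\mathbb Z$-basis $(b_i)$ of $\Lambda^\perp$, and let $\operatorname{vol}(\Lambda^\perp)=|I|$. Let $U$ be a bounded open neighbourhood of $0$ such that the sets $\lambda+U$, $\lambda\in\Lambda$, are pairwise disjoint, and let $\chi\in\mathcal D(U)\setminus\{0\}$. Let $E$ be a solid TMIB or a solid DTMIB. * $E(\mathbb R^n/\Lambda^\perp)$ is the space of all $\Lambda^\perp$-periodic $f\in E_{\mathrm{loc}}=\{f\in\mathcal D'(\mathbb R^n): \varphi f\in E\ \forall\varphi\in\mathcal D(\mathbb R^n)\}$, with norm $\|f\|=\|f1_I\|_E$. * $(\mathcal FE)^0_d(\Lambda)$ is the space of all $c\in\mathbb C^\Lambda$ such that $S_\chi(c)=\sum_{\lambda\in\Lambda}c_\lambda T_\lambda\chi$ belongs to $\mathcal FE=\{g\in\mathcal S'(\mathbb R^n):\mathcal F^{-1}g\in E\}$, with norm $\|c\|=\|S_\chi(c)\|_{\mathcal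 FE}=\|\mathcal F^{-1}S_\chi(c)\|_E$. **Proposition.** Every $f\in E(\mathbb R^n/\Lambda^\perp)$ is a locally integrable function with $f1_I\in E$, and the map $$E(\mathbb R^n/\Lambda^\perp)\to(\mathcal FE)^0_d(\Lambda),\qquad f\mapsto(c_\lambda(f))_{\lambda\in\Lambda},\qquad c_\lambda(f)=\frac1{\operatorname{vol}(\Lambda^\perp)}\int_I f(x)e^{-2\pi i\lambda\cdot x}\,dx,$$ is a well-defined topological isomorphism, that is, a linear bijection such that for some constant $C$ and all $f$ $$\|(c_\lambda(f))_\lambda\|_{(\mathcal FE)^0_d(\Lambda)}\le C\|f\|_{E(\mathbb R^n/\Lambda^\perp)}\quad\text{and}\quad\|f\|_{E(\mathbb R^n/\Lambda^\perp)}\le C\|(c_\lambda(f))_\lambda\|_{(\mathcal FE)^0_d(\Lambda)}.$$ -/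

import Mathlib

open MeasureTheory Set TopologicalSpace
open scoped SchwartzMap Distributions ENNReal NNReal InnerProductSpace

universe u v

noncomputable section

namespace DistSpace

/-! ### Test functions, distributions, translation and modulation -/

/-- The space `ℝⁿ` with its Euclidean norm and inner product. -/
abbrev Eucl (n : ℕ) := EuclideanSpace ℝ (Fin n)

/-- `𝓓(ℝⁿ)`: complex-valued smooth functions with compact support (with the LF topology). -/
abbrev Test (n : ℕ) := 𝓓((⊤ : Opens (Eucl n)), ℂ)

/-- `𝓓'(ℝⁿ)`: continuous complex-linear functionals on `𝓓(ℝⁿ)`. -/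
abbrev Distr (n : ℕ) := Test n →L[ℂ] ℂ

/-- `𝓢'(ℝⁿ)`: tempered distributions. Mathlib gives this space the topology of pointwise
convergence; a linear map from a Banach space into it is continuous for this topology if and only
if it is continuous for the strong topology (by the uniform boundedness principle). -/
abbrev Temp (n : ℕ) := 𝓢'(Eucl n, ℂ)

variable {n : ℕ}

/-- The inclusion `𝓓(ℝⁿ) ⊆ 𝓢(ℝⁿ)`. -/
def Test.toSchwartz (φ : Test n) : 𝓢(Eucl n, ℂ) :=
  φ.hasCompactSupport.toSchwartzMap φ.contDiff

/-- The product `χ φ` of two test functions. -/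
def Test.mul (χ φ : Test n) : Test n where
  toFun t := χ t * φ t
  contDiff' := χ.contDiff.mul φ.contDiff
  hasCompactSupport' := φ.hasCompactSupport.mul_left
  tsupport_subset' := fun _ _ => trivial

/-- The translate `t ↦ φ (t + x)` of a test function. -/
def Test.shift (x : Eucl n) (φ : Test n) : Test n where
  toFun t := φ (t + x)
  contDiff' := φ.contDiff.comp (contDiff_id.add contDiff_const)
  hasCompactSupport' := φ.hasCompactSupport.comp_homeomorph (Homeomorph.addRight x)
  tsupport_subset' := fun _ _ => trivial

/-- The character `t ↦ exp (2 π i ⟪ξ, t⟫)`. -/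
def character (ξ t : Eucl n) : ℂ := Complex.exp (2 * Real.pi * Complex.I * (⟪ξ, t⟫_ℝ : ℝ))

theorem character_hasTemperateGrowth (ξ : Eucl n) : (character ξ).HasTemperateGrowth := by
  have key : ∀ m, iteratedDeriv m (fun s : ℝ => Complex.exp (2 * Real.pi * Complex.I * (s : ℝ))) =
      fun s : ℝ => (2 * Real.pi * Complex.I) ^ m *
        Complex.exp (2 * Real.pi * Complex.I * (s : ℝ)) := by
    intro m
    induction m with
    | zero => simp
    | succ m ih =>
      rw [iteratedDeriv_succ, ih]
      funext s
      have h1 : HasDerivAt (fun s : ℝ => 2 * Real.pi * Complex.I * (s : ℂ))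
          (2 * Real.pi * Complex.I) s := by
        simpa using (hasDerivAt_id s).ofReal_comp.const_mul (2 * Real.pi * Complex.I)
      rw [(h1.cexp.const_mul ((2 * Real.pi * Complex.I) ^ m)).deriv]
      ring
  have h : (fun s : ℝ => Complex.exp (2 * Real.pi * Complex.I * (s : ℝ))).HasTemperateGrowth := by
    refine ⟨?_, fun m => ⟨0, ‖(2 * Real.pi * Complex.I : ℂ) ^ m‖, fun x => ?_⟩⟩
    · exact Complex.contDiff_exp.comp (contDiff_const.mul Complex.ofRealCLM.contDiff)
    · have hx : (2 * Real.pi * Complex.I * (x : ℝ) : ℂ) =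
          ((2 * Real.pi * x : ℝ) : ℂ) * Complex.I := by push_cast; ring
      rw [norm_iteratedFDeriv_eq_norm_iteratedDeriv, key, norm_mul, hx,
        Complex.norm_exp_ofReal_mul_I]
      simp
  exact h.comp (Function.hasTemperateGrowth_inner_right ξ)

/-- Translation `T_x` on `𝓢'(ℝⁿ)`: `⟨T_x f, φ⟩ = ⟨f, φ (· + x)⟩`. -/
def translation (x : Eucl n) : Temp n →L[ℂ] Temp n :=
  PointwiseConvergenceCLM.precomp ℂ (SchwartzMap.compSubConstCLM ℂ (-x))

theorem translation_apply (x : Eucl n) (f : Temp n) (φ : 𝓢(Eucl n, ℂ)) :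
    translation x f φ = f (SchwartzMap.compSubConstCLM ℂ (-x) φ) := rfl

/-- Modulation `M_ξ` on `𝓢'(ℝⁿ)`: multiplication by the character `t ↦ exp (2 π i ⟪ξ, t⟫)`. -/
def modulation (ξ : Eucl n) : Temp n →L[ℂ] Temp n :=
  TemperedDistribution.smulLeftCLM ℂ (character ξ)

/-! ### Banach spaces of distributions

A Banach space `E` that is continuously included in `𝓢'(ℝⁿ)` is given by a complex Banach space
`E` together with an injective continuous linear map `ι : E →L[ℂ] 𝓢'(ℝⁿ)`. -/

section

variable {E : Type u} [NormedAddCommGroup E] [NormedSpace ℂ E]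

/-- `e ∈ E`, viewed as a distribution, is the functional `u` on test functions. -/
def Represents (ι : E →L[ℂ] Temp n) (e : E) (u : Test n → ℂ) : Prop :=
  ∀ φ : Test n, ι e φ.toSchwartz = u φ

/-- The functional `φ ↦ ∫ g φ` on test functions given by a (locally integrable) function `g`. -/
def ofFun (g : Eucl n → ℂ) (φ : Test n) : ℂ := ∫ t, g t * φ t

/-- The norm in `E` of a functional `u` on test functions; it is `∞` if `u ∉ E`. -/
def normIn (ι : E →L[ℂ] Temp n) (u : Test n → ℂ) : ℝ≥0∞ :=
  ⨅ (e : E) (_ : Represents ι e u), ‖e‖ₑ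

/-- `E` (included in `𝓢'(ℝⁿ)` by `ι`) is a translation-modulation invariant Banach space of
distributions. Completeness of `E` is assumed separately. -/
structure IsTMIB (ι : E →L[ℂ] Temp n) : Prop where
  /-- `ι` is an inclusion. -/
  injective : Function.Injective ι
  /-- `𝓢(ℝⁿ)` is contained in `E`, continuously and densely. -/
  schwartz : ∃ j : 𝓢(Eucl n, ℂ) →L[ℂ] E,
    (∀ φ, ι (j φ) = SchwartzMap.toTemperedDistributionCLM (Eucl n) ℂ volume φ) ∧ DenseRange j
  /-- `T_x E ⊆ E` with polynomially bounded operator norms. -/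
  translation : ∃ C > (0 : ℝ), ∃ τ > (0 : ℝ), ∀ (x : Eucl n) (e : E),
    ∃ e' : E, ι e' = translation x (ι e) ∧ ‖e'‖ ≤ C * (1 + ‖x‖) ^ τ * ‖e‖
  /-- `M_ξ E ⊆ E` with polynomially bounded operator norms. -/
  modulation : ∃ C > (0 : ℝ), ∃ τ > (0 : ℝ), ∀ (ξ : Eucl n) (e : E),
    ∃ e' : E, ι e' = modulation ξ (ι e) ∧ ‖e'‖ ≤ C * (1 + ‖ξ‖) ^ τ * ‖e‖

/-- `E` (included in `𝓢'(ℝⁿ)` by `ι`) is the strong dual of a translation-modulation invariant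
Banach space of distributions `E₀`; an element of the dual is the tempered distribution obtained by
restricting it to `𝓢(ℝⁿ) ⊆ E₀`. -/
def IsDTMIB (ι : E →L[ℂ] Temp n) : Prop :=
  ∃ (E₀ : Type v) (_ : NormedAddCommGroup E₀) (_ : NormedSpace ℂ E₀) (_ : CompleteSpace E₀)
    (ι₀ : E₀ →L[ℂ] Temp n) (Φ : E ≃L[ℂ] StrongDual ℂ E₀), IsTMIB ι₀ ∧
    ∀ (e : E) (φ : 𝓢(Eucl n, ℂ)) (e₀ : E₀),
      ι₀ e₀ = SchwartzMap.toTemperedDistributionCLM (Eucl n) ℂ volume φ → ι e φ = Φ e e₀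

/-- `E` is a solid Banach function space on `ℝⁿ` with respect to Lebesgue measure. -/
structure IsSolid (ι : E →L[ℂ] Temp n) : Prop where
  /-- `E ⊆ L¹_loc(ℝⁿ)`. -/
  locallyIntegrable : ∀ e : E, ∃ f : Eucl n → ℂ,
    LocallyIntegrable f volume ∧ Represents ι e (ofFun f)
  /-- The inclusion `E ⊆ L¹_loc(ℝⁿ)` is continuous. -/
  continuous : ∀ K : Set (Eucl n), IsCompact K → ∃ C : ℝ, ∀ (e : E) (f : Eucl n → ℂ),
    LocallyIntegrable f volume → Represents ι e (ofFun f) → ∫ t in K, ‖f t‖ ≤ C * ‖e‖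
  /-- If `f ∈ E`, `g ∈ L¹_loc` and `|g| ≤ |f|` a.e., then `g ∈ E` and `‖g‖ ≤ ‖f‖`. -/
  solid : ∀ (e : E) (f g : Eucl n → ℂ), LocallyIntegrable f volume → Represents ι e (ofFun f) →
    LocallyIntegrable g volume → (∀ᵐ t, ‖g t‖ ≤ ‖f t‖) →
    ∃ e' : E, Represents ι e' (ofFun g) ∧ ‖e'‖ ≤ ‖e‖

/-- The Fourier space `𝓕 E = {f ∈ 𝓢' | 𝓕⁻¹ f ∈ E}` with norm `‖f‖ = ‖𝓕⁻¹ f‖`: it is the Banach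
space `E`, included in `𝓢'(ℝⁿ)` by `𝓕 ∘ ι`. -/
def fourierSpace (ι : E →L[ℂ] Temp n) : E →L[ℂ] Temp n :=
  (FourierTransform.fourierCLM ℂ (Temp n)).comp ι

/-! ### Lattices -/

/-- The dual lattice `Λ^⊥ = {μ | ⟪l, μ⟫ ∈ ℤ for all l ∈ Λ}`. -/
def dualLattice (Λ : Submodule ℤ (Eucl n)) : Submodule ℤ (Eucl n) where
  carrier := {μ | ∀ l ∈ Λ, ∃ k : ℤ, ⟪l, μ⟫_ℝ = k}
  zero_mem' := fun _ _ => ⟨0, by simp⟩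
  add_mem' := by
    intro a b ha hb l hl
    obtain ⟨k, hk⟩ := ha l hl
    obtain ⟨m, hm⟩ := hb l hl
    exact ⟨k + m, by rw [inner_add_right, hk, hm]; push_cast; rfl⟩
  smul_mem' := by
    intro c a ha l hl
    obtain ⟨k, hk⟩ := ha l hl
    refine ⟨c * k, ?_⟩
    rw [← Int.cast_smul_eq_zsmul ℝ c a, inner_smul_right, hk]
    push_cast
    rfl

/-! ### Periodic elements of `E_loc` and their Fourier coefficients -/

/-- `E(ℝⁿ/Λ^⊥)` as a vector space: the distributions `f` with `χ f ∈ E` for all `χ ∈ 𝓓(ℝⁿ)`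
(that is, `f ∈ E_loc`) that are invariant under translation by every `μ ∈ Λ^⊥`. -/
def PeriodicSpace (ι : E →L[ℂ] Temp n) (Λ : Submodule ℤ (Eucl n)) : Submodule ℂ (Distr n) where
  carrier := {f | (∀ χ : Test n, ∃ e : E, Represents ι e (fun φ => f (χ.mul φ))) ∧
    ∀ μ ∈ dualLattice Λ, ∀ φ : Test n, f (φ.shift μ) = f φ}
  zero_mem' := ⟨fun _ => ⟨0, fun _ => by simp⟩, fun _ _ _ => by simp⟩
  add_mem' := by
    rintro f g ⟨hf, hf'⟩ ⟨hg, hg'⟩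
    refine ⟨fun χ => ?_, fun μ hμ φ => by simp [hf' μ hμ φ, hg' μ hμ φ]⟩
    obtain ⟨e, he⟩ := hf χ
    obtain ⟨e', he'⟩ := hg χ
    exact ⟨e + e', fun φ => by simpa using congrArg₂ (· + ·) (he φ) (he' φ)⟩
  smul_mem' := by
    rintro c f ⟨hf, hf'⟩
    refine ⟨fun χ => ?_, fun μ hμ φ => by simp [hf' μ hμ φ]⟩
    obtain ⟨e, he⟩ := hf χ
    exact ⟨c • e, fun φ => by simpa using congrArg (c * ·) (he φ)⟩

/-- The distribution `f` is the locally integrable function `g`. -/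
def IsFunction (f : Distr n) (g : Eucl n → ℂ) : Prop :=
  LocallyIntegrable g volume ∧ ∀ φ : Test n, f φ = ofFun g φ

open Classical in
/-- The locally integrable function (unique up to a null set) that the distribution `f` is;
by convention it is `0` if `f` is not a locally integrable function. -/
def density (f : Distr n) : Eucl n → ℂ :=
  if h : ∃ g, IsFunction f g then h.choose else 0

/-- `‖f‖_{E(ℝⁿ/Λ^⊥)} = ‖f 1_I‖_E`, where `I` is the fundamental parallelepiped spanned by the basis
`b` of the lattice `Λ^⊥`; it is `∞` if `f 1_I ∉ E`. -/
def periodicNorm (ι : E →L[ℂ] Temp n) (b : Module.Basis (Fin n) ℝ (Eucl n)) (f : Distr n) : ℝ≥0∞ :=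
  normIn ι (ofFun ((ZSpan.fundamentalDomain b).indicator (density f)))

/-- The Fourier coefficient `c_l(f) = vol(I)⁻¹ ∫_I f(x) exp (-2 π i ⟪l, x⟫) dx`, where `I` is the
fundamental parallelepiped spanned by the basis `b` of the lattice `Λ^⊥`. -/
def fourierCoefficient (b : Module.Basis (Fin n) ℝ (Eucl n)) (f : Distr n) (l : Eucl n) : ℂ :=
  ((volume.real (ZSpan.fundamentalDomain b) : ℝ) : ℂ)⁻¹ *
    ∫ x in ZSpan.fundamentalDomain b, density f x * character (-l) x

/-! ### The discrete space associated to `E` -/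

/-- The twisted translation `T^B_x f (t) = f (t - x) exp (-2 π i ⟪B x, t - x⟫)`. -/
def twistedTranslation (B : Matrix (Fin n) (Fin n) ℝ) (x : Eucl n) (f : Eucl n → ℂ) :
    Eucl n → ℂ :=
  fun t => f (t - x) * character (-(B.toEuclideanLin x)) (t - x)

/-- The distribution `S_χ(c) = ∑_{l ∈ Λ} c_l T^B_l χ`. Tested against `φ ∈ 𝓓(ℝⁿ)`, only finitely
many terms are non-zero. -/
def synthesis (B : Matrix (Fin n) (Fin n) ℝ) (Λ : Submodule ℤ (Eucl n)) (χ : Eucl n → ℂ)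
    (c : Λ → ℂ) (φ : Test n) : ℂ :=
  ∑ᶠ l : Λ, c l * ofFun (twistedTranslation B (l : Eucl n) χ) φ

theorem synthesis_support_finite (B : Matrix (Fin n) (Fin n) ℝ) (Λ : Submodule ℤ (Eucl n))
    [DiscreteTopology Λ] {U : Opens (Eucl n)} (χ : 𝓓(U, ℂ)) (c : Λ → ℂ) (φ : Test n) :
    (Function.support fun l : Λ =>
      c l * ofFun (twistedTranslation B (l : Eucl n) χ) φ).Finite := by
  have hK : IsCompact ((fun p : Eucl n × Eucl n => p.1 - p.2) '' (tsupport φ ×ˢ tsupport χ)) :=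
    ((show IsCompact (tsupport φ) from φ.hasCompactSupport).prod
      (show IsCompact (tsupport χ) from χ.hasCompactSupport)).image continuous_sub
  have hΛ : IsClosed (Λ : Set (Eucl n)) :=
    @AddSubgroup.isClosed_of_discrete _ _ _ _ _ Λ.toAddSubgroup ‹_›
  have hfin := Metric.finite_isBounded_inter_isClosed (s := (Λ : Set (Eucl n)))
    DiscreteTopology.isDiscrete hK.isBounded hΛ
  refine (hfin.preimage (f := ((↑) : Λ → Eucl n)) Subtype.val_injective.injOn).subset ?_
  intro l hl
  refine ⟨?_, l.2⟩
  by_contra hn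
  apply hl
  have h0 : ofFun (twistedTranslation B (l : Eucl n) χ) φ = 0 := by
    unfold ofFun twistedTranslation
    rw [← integral_zero (Eucl n) ℂ (μ := volume)]
    congr 1
    funext t
    by_cases h1 : χ (t - l) = 0
    · simp [h1]
    by_cases h2 : φ t = 0
    · simp [h2]
    exact absurd ⟨(t, t - l), ⟨subset_tsupport _ h2, subset_tsupport _ h1⟩, by simp⟩ hn
  simp [h0]

/-- The discrete space `E^B_d(Λ) = {c ∈ ℂ^Λ | S_χ(c) ∈ E}` as a vector space. -/
def DiscreteSpace (ι : E →L[ℂ] Temp n) (B : Matrix (Fin n) (Fin n) ℝ) (Λ : Submodule ℤ (Eucl n))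
    [DiscreteTopology Λ] {U : Opens (Eucl n)} (χ : 𝓓(U, ℂ)) : Submodule ℂ (Λ → ℂ) where
  carrier := {c | ∃ e : E, Represents ι e (synthesis B Λ χ c)}
  zero_mem' := ⟨0, fun φ => by simp [synthesis]⟩
  add_mem' := by
    rintro c d ⟨e, he⟩ ⟨e', he'⟩
    refine ⟨e + e', fun φ => ?_⟩
    have h := finsum_add_distrib (synthesis_support_finite B Λ χ c φ)
      (synthesis_support_finite B Λ χ d φ)
    have h1 := he φ
    have h2 := he' φ
    simp only [synthesis, Pi.add_apply, add_mul] at h1 h2 ⊢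
    rw [h, ← h1, ← h2]
    simp
  smul_mem' := by
    rintro a c ⟨e, he⟩
    refine ⟨a • e, fun φ => ?_⟩
    have h := smul_finsum' a (synthesis_support_finite B Λ χ c φ)
    have h1 := he φ
    simp only [synthesis, Pi.smul_apply, smul_eq_mul, mul_assoc] at h h1 ⊢
    rw [← h, ← h1]
    simp

/-- `‖c‖ = ‖S_χ(c)‖_E`; it is `∞` if `S_χ(c) ∉ E`. -/
def discreteNorm (ι : E →L[ℂ] Temp n) (B : Matrix (Fin n) (Fin n) ℝ) (Λ : Submodule ℤ (Eucl n))
    {U : Opens (Eucl n)} (χ : 𝓓(U, ℂ)) (c : Λ → ℂ) : ℝ≥0∞ :=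
  normIn ι (synthesis B Λ χ c)

end

end DistSpace

end

open DistSpace

noncomputable section

namespace DistSpace

open Filter Topology FourierTransform Convolution
open scoped ContDiff Pointwise

variable {n : ℕ}

/-! ### Test functions are dense in the Schwartz space -/

/-! Put ψ = 𝓕⁻¹χ, written `𝓕 (reflect χ)` below. Since S_χ(c) is the convolution of χ with ∑ c_λ
δ_λ, its inverse Fourier transform is ψ times the Fourier series with coefficients c. For the
coefficients of a periodic f this product is ψf (`represents_synthesis`, by Poisson summation). The
claim thus becomes: ‖ψf‖_E and ‖f 1_I‖_E are equivalent, and every c in the discrete space arises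
from some f.

Upper bound (`exists_rep_schwartz_mul`): cut ψf along the translates μ + I. Solidity and the
polynomial bound on translations control each piece by ‖f 1_I‖_E times a factor that is summable in
μ, because ψ decays rapidly.

Lower bound (`exists_rep_indicator`): because the sets λ + U are disjoint, ψ cannot vanish on a
whole coset x + Λ^⊥, again by Poisson summation. By compactness a finite sum ∑ |ψ(x + μ)|² is
bounded below on I, so |f| 1_I is dominated by finitely many translates of |ψf|.

Surjectivity (`exists_periodic_of_synthesis`): g = 𝓕⁻¹ S_χ(c) satisfies g(x + μ) ψ(x) = g(x) ψ(x +
μ), so the quotient g/ψ can be formed as a periodic function in spite of the zeros of ψ.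
Disjointness of the λ + U also shows that S_χ(c) determines c. -/

@[simp] theorem Test.toSchwartz_apply (φ : Test n) (t : Eucl n) : φ.toSchwartz t = φ t := rfl

/-- A smooth compactly supported function as a test function. -/
def Test.mk' (f : Eucl n → ℂ) (hf : ContDiff ℝ ∞ f) (hc : HasCompactSupport f) : Test n where
  toFun := f
  contDiff' := hf
  hasCompactSupport' := hc
  tsupport_subset' := fun _ _ => trivial

@[simp] theorem Test.mk'_apply (f : Eucl n → ℂ) (hf : ContDiff ℝ ∞ f) (hc : HasCompactSupport f)
    (t : Eucl n) : Test.mk' f hf hc t = f t := rfl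

@[simp] theorem Test.mul_apply (χ φ : Test n) (t : Eucl n) : χ.mul φ t = χ t * φ t := rfl

@[simp] theorem Test.shift_apply (x : Eucl n) (φ : Test n) (t : Eucl n) :
    φ.shift x t = φ (t + x) := rfl

/-- A smooth compactly supported real function as a complex test function. -/
def Test.ofReal (η : Eucl n → ℝ) (hη : ContDiff ℝ ∞ η) (hc : HasCompactSupport η) : Test n :=
  Test.mk' (fun t => (η t : ℂ)) (Complex.ofRealCLM.contDiff.comp hη)
    (hc.comp_left (g := fun x : ℝ => (x : ℂ)) (by simp))

@[simp] theorem Test.ofReal_apply (η : Eucl n → ℝ) (hη : ContDiff ℝ ∞ η) (hc : HasCompactSupport η)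
    (t : Eucl n) : Test.ofReal η hη hc t = (η t : ℂ) := rfl

/-- A compactly supported Schwartz function as a test function. -/
def Test.ofSchwartz (f : 𝓢(Eucl n, ℂ)) (hf : HasCompactSupport f) : Test n :=
  Test.mk' f (f.smooth ⊤) hf

@[simp] theorem Test.ofSchwartz_toSchwartz (f : 𝓢(Eucl n, ℂ)) (hf : HasCompactSupport f) :
    (Test.ofSchwartz f hf).toSchwartz = f := by
  ext t; rfl

theorem exists_test_eq_one (R : ℝ) :
    ∃ ρ : Test n, (∀ t, ‖t‖ ≤ R → ρ t = 1) ∧ ∀ t, ‖ρ t‖ ≤ 1 := by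
  let B : ContDiffBump (0 : Eucl n) := ⟨|R| + 1, |R| + 2, by positivity, by linarith⟩
  refine ⟨Test.ofReal B B.contDiff B.hasCompactSupport, ?_, ?_⟩
  · intro t ht
    have : B t = 1 := B.one_of_mem_closedBall (by
      simp only [Metric.mem_closedBall, dist_zero_right, B]
      linarith [le_abs_self R])
    simp [this]
  · intro t
    simp only [Test.ofReal_apply, Complex.norm_real, Real.norm_eq_abs, abs_of_nonneg B.nonneg]
    exact B.le_one

theorem norm_iteratedFDeriv_comp_const_smul_le {f : Eucl n → ℂ} (hf : ContDiff ℝ ∞ f) {ε : ℝ}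
    (hε : |ε| ≤ 1) (i : ℕ) (x : Eucl n) :
    ‖iteratedFDeriv ℝ i (fun x => f (ε • x)) x‖ ≤ ‖iteratedFDeriv ℝ i f (ε • x)‖ := by
  let A : Eucl n →L[ℝ] Eucl n := ε • ContinuousLinearMap.id ℝ (Eucl n)
  have h := A.iteratedFDeriv_comp_right hf x (i := i) (by exact_mod_cast le_top)
  have h' : (fun x => f (ε • x)) = f ∘ A := by ext y; simp [A]
  rw [h', h]
  refine (ContinuousMultilinearMap.norm_compContinuousLinearMap_le _ _).trans ?_
  have hA : ‖A‖ ≤ 1 := by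
    refine (ContinuousLinearMap.opNorm_le_bound _ zero_le_one fun y => ?_)
    rw [show A y = ε • y from rfl, norm_smul, Real.norm_eq_abs]
    gcongr
  have : ∏ _j : Fin i, ‖A‖ ≤ 1 := Finset.prod_le_one (fun _ _ => norm_nonneg _) (fun _ _ => hA)
  exact (mul_le_of_le_one_right (norm_nonneg _) this).trans (by simp [A])

/-- The approximants are the truncations ρ(x / (m + 1)) h(x), where ρ = 1 near the unit ball. -/
theorem exists_test_tendsto (h : 𝓢(Eucl n, ℂ)) :
    ∃ φ : ℕ → Test n, Tendsto (fun m => (φ m).toSchwartz) atTop (𝓝 h) := by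
  obtain ⟨ρ, hρ1, -⟩ := exists_test_eq_one (n := n) 2
  have hε0 : ∀ m : ℕ, (0 : ℝ) < 1 / ((m : ℝ) + 1) := fun m => by positivity
  have hε1 : ∀ m : ℕ, |1 / ((m : ℝ) + 1)| ≤ 1 := fun m => by
    rw [abs_of_pos (hε0 m), div_le_one (by positivity)]
    linarith [(Nat.cast_nonneg m : (0 : ℝ) ≤ m)]
  let r : ℕ → Test n := fun m => Test.mk' (fun x => ρ ((1 / ((m : ℝ) + 1)) • x))
    (ρ.contDiff.comp (contDiff_const_smul _)) (ρ.hasCompactSupport.comp_smul (hε0 m).ne')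
  let ψ : ℕ → Test n := fun m => Test.mk' (fun x => ρ ((1 / ((m : ℝ) + 1)) • x) * h x)
    ((r m).contDiff.mul (h.smooth ⊤)) ((r m).hasCompactSupport.mul_right)
  refine ⟨ψ, ?_⟩
  rw [(schwartz_withSeminorms ℂ (Eucl n) ℂ).tendsto_nhds]
  rintro ⟨k, l⟩ δ hδ
  -- The error is σ(x / (m + 1)) h(x); it vanishes for ‖x‖ < m + 1, and the derivatives of σ are
  -- bounded.
  let σ : Eucl n → ℂ := fun x => ρ x - 1
  have hσ : ContDiff ℝ ∞ σ := ρ.contDiff.sub contDiff_const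
  have hB : ∀ i : ℕ, ∃ B : ℝ, 0 ≤ B ∧ ∀ x, ‖iteratedFDeriv ℝ i σ x‖ ≤ B := by
    intro i
    refine ⟨SchwartzMap.seminorm ℝ 0 i ρ.toSchwartz + 1, by positivity, fun x => ?_⟩
    have h1 : iteratedFDeriv ℝ i σ x = iteratedFDeriv ℝ i (ρ : Eucl n → ℂ) x -
        iteratedFDeriv ℝ i (fun _ : Eucl n => (1 : ℂ)) x :=
      fun_iteratedFDeriv_sub_apply (ρ.contDiff.of_le (by exact_mod_cast le_top)).contDiffAt contDiff_const.contDiffAt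
    rw [h1]
    refine (norm_sub_le _ _).trans (add_le_add ?_ ?_)
    · exact ρ.toSchwartz.norm_iteratedFDeriv_le_seminorm ℝ i x
    · rcases Nat.eq_zero_or_pos i with rfl | hi
      · simp
      · rw [iteratedFDeriv_const_of_ne hi.ne']; simp
  choose B hB0 hB using hB
  let C : ℝ := ∑ i ∈ Finset.range (l + 1), (l.choose i : ℝ) * B i *
    SchwartzMap.seminorm ℝ (k + 1) (l - i) h
  have hC : 0 ≤ C := Finset.sum_nonneg fun i _ => by have := hB0 i; positivity
  have key : ∀ m : ℕ, SchwartzMap.seminorm ℂ k l ((ψ m).toSchwartz - h) ≤ 1 / ((m : ℝ) + 1) * C := by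
    intro m
    refine SchwartzMap.seminorm_le_bound ℂ k l _ (by have := (hε0 m).le; positivity) fun x => ?_
    have heq : ⇑((ψ m).toSchwartz - h) = fun x => σ ((1 / ((m : ℝ) + 1)) • x) * h x := by
      ext y
      simp [ψ, σ, sub_mul]
    rw [heq]
    rcases lt_or_ge ‖x‖ ((m : ℝ) + 1) with hx | hx
    · have : (fun x => σ ((1 / ((m : ℝ) + 1)) • x) * h x) =ᶠ[𝓝 x] fun _ => 0 := by
        have hopen : {y : Eucl n | ‖y‖ < (m : ℝ) + 1} ∈ 𝓝 x :=
          (isOpen_lt continuous_norm continuous_const).mem_nhds hx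
        filter_upwards [hopen] with y hy
        have : ‖(1 / ((m : ℝ) + 1)) • y‖ ≤ 2 := by
          rw [norm_smul, Real.norm_eq_abs, abs_of_pos (hε0 m), one_div, inv_mul_le_iff₀ (by positivity)]
          have : ‖y‖ < (m : ℝ) + 1 := hy
          linarith [(Nat.cast_nonneg m : (0 : ℝ) ≤ m)]
        simp only [σ, hρ1 _ this, sub_self, zero_mul]
      rw [(this.iteratedFDeriv ℝ l).self_of_nhds]
      have h0 : iteratedFDeriv ℝ l (fun _ : Eucl n => (0 : ℂ)) x = 0 := by
        simp
      rw [h0]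
      have := (hε0 m).le
      simp only [norm_zero, mul_zero]
      positivity
    · have h1 := norm_iteratedFDeriv_mul_le (hσ.comp (contDiff_const_smul (1 / ((m : ℝ) + 1))))
        (h.smooth ⊤) x (n := l) (by exact_mod_cast le_top)
      refine (mul_le_mul_of_nonneg_left h1 (by positivity)).trans ?_
      rw [Finset.mul_sum, Finset.mul_sum]
      refine Finset.sum_le_sum fun i _ => ?_
      have h2 := (norm_iteratedFDeriv_comp_const_smul_le hσ (hε1 m) i x).trans (hB i _)
      have h3 := h.le_seminorm ℝ (k + 1) (l - i) x
      -- Smallness comes from 1 ≤ ‖x‖ / (m + 1), at the cost of one more power of ‖x‖; hence the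
      -- index k + 1 in `C`.
      have h4 : ‖x‖ ^ k ≤ 1 / ((m : ℝ) + 1) * ‖x‖ ^ (k + 1) := by
        rw [one_div, le_inv_mul_iff₀ (by positivity), pow_succ, mul_comm]
        gcongr
      calc ‖x‖ ^ k * ((l.choose i : ℝ) * ‖iteratedFDeriv ℝ i (σ ∘ fun x => (1 / ((m : ℝ) + 1)) • x) x‖ *
            ‖iteratedFDeriv ℝ (l - i) (⇑h) x‖)
          ≤ (1 / ((m : ℝ) + 1) * ‖x‖ ^ (k + 1)) * ((l.choose i : ℝ) * B i *
            ‖iteratedFDeriv ℝ (l - i) (⇑h) x‖) := by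
            have := hB0 i
            gcongr
            exact h2
        _ = 1 / ((m : ℝ) + 1) * ((l.choose i : ℝ) * B i *
            (‖x‖ ^ (k + 1) * ‖iteratedFDeriv ℝ (l - i) (⇑h) x‖)) := by ring
        _ ≤ _ := by
            have := hB0 i
            have := (hε0 m).le
            gcongr
  have hlim : Tendsto (fun m : ℕ => 1 / ((m : ℝ) + 1) * C) atTop (𝓝 0) := by
    simpa using tendsto_one_div_add_atTop_nhds_zero_nat.mul_const C
  filter_upwards [hlim.eventually (gt_mem_nhds hδ)] with m hm
  exact (key m).trans_lt hm

theorem eq_of_forall_test {u w : 𝓢(Eucl n, ℂ) → ℂ} (hu : Continuous u) (hw : Continuous w)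
    (h : ∀ φ : Test n, u φ.toSchwartz = w φ.toSchwartz) (f : 𝓢(Eucl n, ℂ)) : u f = w f := by
  obtain ⟨φ, hφ⟩ := exists_test_tendsto f
  refine tendsto_nhds_unique ((hu.tendsto f).comp hφ) ?_
  refine ((hw.tendsto f).comp hφ).congr fun m => ?_
  exact (h _).symm

/-! ### Locally integrable functions as distributions -/

theorem integrable_mul_test {g : Eucl n → ℂ} (hg : LocallyIntegrable g volume) (φ : Test n) :
    Integrable (fun t => g t * φ t) := by
  have := hg.integrable_smul_left_of_hasCompactSupport φ.continuous φ.hasCompactSupport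
  simpa [smul_eq_mul, mul_comm] using this

theorem ae_eq_of_ofFun_eq {f g : Eucl n → ℂ} (hf : LocallyIntegrable f volume)
    (hg : LocallyIntegrable g volume) (h : ∀ φ : Test n, ofFun f φ = ofFun g φ) : f =ᵐ[volume] g := by
  refine ae_eq_of_integral_contDiff_smul_eq hf hg fun η hη hc => ?_
  have := h (Test.ofReal η hη hc)
  simpa [ofFun, mul_comm] using this

/-- Local form of uniqueness, needed to glue local densities of an element of E_loc. -/
theorem ae_eq_on_ball_of_ofFun_eq {f g : Eucl n → ℂ} (hf : LocallyIntegrable f volume)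
    (hg : LocallyIntegrable g volume) {R : ℝ}
    (h : ∀ φ : Test n, tsupport φ ⊆ Metric.ball 0 R → ofFun f φ = ofFun g φ) :
    ∀ᵐ x, x ∈ Metric.ball (0 : Eucl n) R → f x = g x := by
  have := Metric.isOpen_ball.ae_eq_zero_of_integral_contDiff_smul_eq_zero (U := Metric.ball (0 : Eucl n) R)
    (μ := volume) (f := fun x => f x - g x) ((hf.sub hg).locallyIntegrableOn _) ?_
  · filter_upwards [this] with x hx hxR
    exact sub_eq_zero.1 (hx hxR)
  intro η hη hc hs
  let φ := Test.ofReal η hη hc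
  have h1 := h φ ((closure_mono fun x hx => by
    simpa [φ] using hx : tsupport φ ⊆ tsupport η).trans hs)
  have h2 := integral_sub (integrable_mul_test hf φ) (integrable_mul_test hg φ)
  simp only [ofFun] at h1
  rw [h1, sub_self] at h2
  rw [← h2]
  congr 1
  ext x
  simp [φ]
  ring

theorem ofFun_congr {f g : Eucl n → ℂ} (h : f =ᵐ[volume] g) (φ : Test n) : ofFun f φ = ofFun g φ :=
  integral_congr_ae (by filter_upwards [h] with x hx; rw [hx])

theorem _root_.MeasureTheory.LocallyIntegrable.of_norm_le {f g : Eucl n → ℂ}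
    (hf : LocallyIntegrable f volume) (hg : AEStronglyMeasurable g volume) {C : ℝ}
    (h : ∀ᵐ x, ‖g x‖ ≤ C * ‖f x‖) : LocallyIntegrable g volume :=
  LocallyIntegrable.mono (f := fun x => C * ‖f x‖) (fun x => ((hf x).norm.smul C)) hg (by
    filter_upwards [h] with x hx
    exact hx.trans (le_abs_self _))

theorem _root_.MeasureTheory.LocallyIntegrable.comp_add_const {f : Eucl n → ℂ}
    (hf : LocallyIntegrable f volume) (x : Eucl n) : LocallyIntegrable (fun t => f (t + x)) volume := by
  rw [locallyIntegrable_iff] at hf ⊢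
  intro K hK
  have := hf _ (hK.image (continuous_add_const x))
  have h2 := (measurePreserving_add_right volume x).integrableOn_image (MeasurableEquiv.addRight x).measurableEmbedding (s := K) (f := f)
  exact h2.1 this

/-! ### Characters -/

theorem character_eq (ξ t : Eucl n) :
    character ξ t = Complex.exp (((2 * Real.pi * ⟪ξ, t⟫_ℝ : ℝ) : ℂ) * Complex.I) := by
  unfold character; congr 1; push_cast; ring

theorem norm_character (ξ t : Eucl n) : ‖character ξ t‖ = 1 := by
  rw [character_eq, Complex.norm_exp_ofReal_mul_I]

theorem character_comm (ξ t : Eucl n) : character ξ t = character t ξ := by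
  rw [character, character, real_inner_comm]

theorem character_add_right (ξ s t : Eucl n) :
    character ξ (s + t) = character ξ s * character ξ t := by
  simp only [character_eq, ← Complex.exp_add, inner_add_right]
  congr 1; push_cast; ring

theorem character_add_left (ξ η t : Eucl n) :
    character (ξ + η) t = character ξ t * character η t := by
  rw [character_comm, character_add_right, character_comm t, character_comm t]

@[simp] theorem character_zero_left (t : Eucl n) : character 0 t = 1 := by simp [character]

theorem continuous_character (ξ : Eucl n) : Continuous (character ξ) := by
  unfold character; fun_prop

theorem character_eq_one_of_inner_eq_int {ξ t : Eucl n} {k : ℤ} (h : ⟪ξ, t⟫_ℝ = k) :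
    character ξ t = 1 := by
  rw [character, h, Complex.exp_eq_one_iff]
  exact ⟨k, by push_cast; ring⟩

/-! ### Fourier transforms and convolutions of Schwartz functions -/

theorem fourier_apply_eq (f : 𝓢(Eucl n, ℂ)) (w : Eucl n) :
    𝓕 f w = ∫ t, character (-w) t * f t := by
  rw [SchwartzMap.fourier_coe, Real.fourier_eq']
  congr 1
  ext t
  rw [smul_eq_mul, character_eq, real_inner_comm, inner_neg_left]
  congr 2; push_cast; ring

theorem fourierInv_apply_eq' (f : 𝓢(Eucl n, ℂ)) (w : Eucl n) :
    𝓕⁻ f w = ∫ t, character w t * f t := by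
  rw [SchwartzMap.fourierInv_coe, Real.fourierInv_eq']
  congr 1
  ext t
  rw [smul_eq_mul, character_eq, real_inner_comm]

/-- Modulation on the Schwartz space. -/
def schwartzMod (ξ : Eucl n) : 𝓢(Eucl n, ℂ) →L[ℂ] 𝓢(Eucl n, ℂ) :=
  SchwartzMap.smulLeftCLM ℂ (character ξ)

@[simp] theorem schwartzMod_apply (ξ : Eucl n) (f : 𝓢(Eucl n, ℂ)) (t : Eucl n) :
    schwartzMod ξ f t = character ξ t * f t := by
  rw [schwartzMod, SchwartzMap.smulLeftCLM_apply_apply (character_hasTemperateGrowth ξ), smul_eq_mul]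

theorem fourier_schwartzMod (ξ : Eucl n) (f : 𝓢(Eucl n, ℂ)) (w : Eucl n) :
    𝓕 (schwartzMod ξ f) w = 𝓕 f (w - ξ) := by
  rw [fourier_apply_eq, fourier_apply_eq]
  congr 1
  ext t
  rw [schwartzMod_apply, ← mul_assoc, ← character_add_left]
  congr 2; abel

theorem fourier_compSubConst (a : Eucl n) (f : 𝓢(Eucl n, ℂ)) (w : Eucl n) :
    𝓕 (SchwartzMap.compSubConstCLM ℂ a f) w = character (-w) a * 𝓕 f w := by
  rw [fourier_apply_eq, fourier_apply_eq, ← integral_const_mul,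
    ← integral_add_right_eq_self _ a]
  congr 1
  ext t
  rw [SchwartzMap.compSubConstCLM_apply, add_sub_cancel_right, character_add_right]
  ring

/-- Convolution of Schwartz functions. -/
def conv (f g : 𝓢(Eucl n, ℂ)) : 𝓢(Eucl n, ℂ) :=
  SchwartzMap.convolution (ContinuousLinearMap.mul ℂ ℂ) f g

theorem conv_apply (f g : 𝓢(Eucl n, ℂ)) (x : Eucl n) : conv f g x = ∫ t, f t * g (x - t) := by
  rw [conv, SchwartzMap.convolution_apply]
  rfl

theorem fourier_conv_apply (f g : 𝓢(Eucl n, ℂ)) (x : Eucl n) :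
    𝓕 (conv f g) x = 𝓕 f x * 𝓕 g x := by
  rw [conv, SchwartzMap.fourier_convolution]
  rfl

theorem fourier_injective : Function.Injective (𝓕 : 𝓢(Eucl n, ℂ) → 𝓢(Eucl n, ℂ)) :=
  fun f g h => by
    have := congrArg (𝓕⁻ : 𝓢(Eucl n, ℂ) → 𝓢(Eucl n, ℂ)) h
    simpa using this

/-- The Fourier transform is injective and turns convolution into a pointwise product, where the
identity is commutativity. -/
theorem conv_left_comm (f g h : 𝓢(Eucl n, ℂ)) : conv f (conv g h) = conv g (conv f h) :=
  fourier_injective (by ext x; simp only [fourier_conv_apply]; ring)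

theorem schwartzMod_conv (ξ : Eucl n) (f g : 𝓢(Eucl n, ℂ)) :
    schwartzMod ξ (conv f g) = conv (schwartzMod ξ f) (schwartzMod ξ g) :=
  fourier_injective (by ext x; simp only [fourier_conv_apply, fourier_schwartzMod])

theorem hasCompactSupport_conv {f g : 𝓢(Eucl n, ℂ)} (hf : HasCompactSupport f)
    (hg : HasCompactSupport g) : HasCompactSupport (conv f g) := by
  have h := hf.convolution (μ := volume) (ContinuousLinearMap.mul ℂ ℂ) hg
  have : ⇑(conv f g) = (f ⋆[ContinuousLinearMap.mul ℂ ℂ, volume] g) := by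
    ext x; rw [conv, SchwartzMap.convolution_apply]
  rwa [this]

theorem hasCompactSupport_schwartzMod (ξ : Eucl n) {f : 𝓢(Eucl n, ℂ)} (hf : HasCompactSupport f) :
    HasCompactSupport (schwartzMod ξ f) := by
  have : ⇑(schwartzMod ξ f) = fun t => character ξ t * f t := by ext; simp
  rw [this]
  exact hf.mul_left

/-- The reflection `t ↦ χ (-t)` of a test function. -/
def reflect {U : Opens (Eucl n)} (χ : 𝓓(U, ℂ)) : 𝓢(Eucl n, ℂ) :=
  (χ.hasCompactSupport.comp_homeomorph (Homeomorph.neg (Eucl n))).toSchwartzMap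
    (χ.contDiff.comp contDiff_neg)

@[simp] theorem reflect_apply {U : Opens (Eucl n)} (χ : 𝓓(U, ℂ)) (t : Eucl n) :
    reflect χ t = χ (-t) := rfl

theorem hasCompactSupport_reflect {U : Opens (Eucl n)} (χ : 𝓓(U, ℂ)) :
    HasCompactSupport (reflect χ) :=
  χ.hasCompactSupport.comp_homeomorph (Homeomorph.neg (Eucl n))

/-- For B = 0 the twist is trivial. Testing S_χ(c) thereby amounts to sampling one convolution at
the points of Λ, which is the form that Poisson summation handles. -/
theorem ofFun_twistedTranslation_zero {U : Opens (Eucl n)} (χ : 𝓓(U, ℂ)) (l : Eucl n) (φ : Test n) :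
    ofFun (twistedTranslation 0 l χ) φ = conv (reflect χ) φ.toSchwartz l := by
  rw [conv_apply, ofFun, ← integral_sub_left_eq_self _ _ l]
  congr 1
  ext t
  simp [twistedTranslation]

theorem synthesis_zero_eq (Λ : Submodule ℤ (Eucl n)) {U : Opens (Eucl n)} (χ : 𝓓(U, ℂ))
    (c : Λ → ℂ) (φ : Test n) :
    synthesis 0 Λ χ c φ = ∑ᶠ l : Λ, c l * conv (reflect χ) φ.toSchwartz (l : Eucl n) := by
  simp only [synthesis, ofFun_twistedTranslation_zero]

/-! ### The dual lattice -/

section Lattice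

variable {Λ : Submodule ℤ (Eucl n)} {b : Module.Basis (Fin n) ℝ (Eucl n)}

theorem character_eq_one_of_mem {l μ : Eucl n} (hl : l ∈ Λ) (hμ : μ ∈ dualLattice Λ) :
    character l μ = 1 := by
  obtain ⟨k, hk⟩ := hμ l hl
  exact character_eq_one_of_inner_eq_int hk

/-- This is Λ^⊥⊥ = Λ, valid because Λ has full rank; integrality on Λ^⊥ need only be checked on the
basis `b`. -/
theorem mem_of_inner_basis_eq_int [DiscreteTopology Λ] [IsZLattice ℝ Λ]
    (hb : Submodule.span ℤ (Set.range b) = dualLattice Λ) {v : Eucl n}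
    (hv : ∀ i, ∃ k : ℤ, ⟪v, b i⟫_ℝ = k) : v ∈ Λ := by
  let B : LinearMap.BilinForm ℝ (Eucl n) := innerₗ (Eucl n)
  have hB : B.Nondegenerate := by
    constructor
    · intro x hx
      exact inner_self_eq_zero.1 (hx x)
    · intro x hx
      exact inner_self_eq_zero.1 (hx x)
  have hB' : B.IsSymm := ⟨fun x y => real_inner_comm y x⟩
  have hone : ∀ r : ℝ, r ∈ (1 : Submodule ℤ ℝ) ↔ ∃ k : ℤ, r = k := by
    intro r
    rw [Submodule.mem_one]
    simp [eq_comm]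
  have := ZLattice.module_finite ℝ Λ
  have := ZLattice.module_free ℝ Λ
  let β := (Module.Free.chooseBasis ℤ Λ).ofZLatticeBasis ℝ Λ
  have hβ : Submodule.span ℤ (Set.range β) = Λ := Module.Basis.ofZLatticeBasis_span ℝ Λ _
  have h1 : B.dualSubmodule Λ = dualLattice Λ := by
    ext x
    rw [LinearMap.BilinForm.mem_dualSubmodule]
    refine forall₂_congr fun l _ => ?_
    rw [hone, real_inner_comm]
    rfl
  have h2 := LinearMap.BilinForm.dualSubmodule_dualSubmodule_of_basis (R := ℤ) B hB hB' β
  rw [hβ, h1, ← hb] at h2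
  rw [← h2, LinearMap.BilinForm.mem_dualSubmodule]
  intro y hy
  rw [hone]
  induction hy using Submodule.span_induction with
  | mem x hx => obtain ⟨i, rfl⟩ := hx; exact hv i
  | zero => exact ⟨0, by simp⟩
  | add x y _ _ hx hy =>
    obtain ⟨k, hk⟩ := hx
    obtain ⟨m, hm⟩ := hy
    exact ⟨k + m, by rw [map_add, hk, hm]; push_cast; rfl⟩
  | smul a x _ hx =>
    obtain ⟨k, hk⟩ := hx
    exact ⟨a * k, by rw [map_zsmul, hk]; simp⟩

/-! ### Decay of Schwartz functions along a lattice -/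

theorem exists_decay (h : 𝓢(Eucl n, ℂ)) (N : ℕ) :
    ∃ C : ℝ, 0 ≤ C ∧ ∀ x, (1 + ‖x‖) ^ N * ‖h x‖ ≤ C := by
  refine ⟨_, ?_, fun x => by
    simpa using SchwartzMap.one_add_le_sup_seminorm_apply (𝕜 := ℝ) (m := (N, 0)) le_rfl le_rfl h x⟩
  positivity

theorem summable_inv_one_add_norm_pow (M : Submodule ℤ (Eucl n)) [DiscreteTopology M] {N : ℕ}
    (hN : Module.finrank ℤ M < N) : Summable fun μ : M => ((1 + ‖(μ : Eucl n)‖) ^ N)⁻¹ := by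
  classical
  have h1 := ZLattice.summable_norm_pow_inv M N hN
  -- The inverse power of ‖μ‖ is 0 at μ = 0 by convention, so the value 1 needed there is added
  -- separately.
  have h2 : Summable fun μ : M => if μ = 0 then (1 : ℝ) else 0 :=
    summable_of_ne_finset_zero (s := {0}) fun μ hμ => by simp at hμ; simp [hμ]
  refine Summable.of_nonneg_of_le (fun μ => by positivity) (fun μ => ?_) (h1.add h2)
  by_cases hμ : μ = 0
  · subst hμ
    simp
  · have : 0 < ‖μ‖ := norm_pos_iff.2 hμ
    simp only [hμ, if_false, add_zero]
    rw [← inv_pow]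
    have h3 : ‖(μ : Eucl n)‖ = ‖μ‖ := rfl
    rw [h3]
    gcongr
    linarith

/-- Decay of order p + rank + 1 and the triangle inequality give the bound uniformly for ‖x‖ ≤ R.
The weight of order p is there to absorb the growth of translation norms on E. -/
theorem exists_summable_bound (M : Submodule ℤ (Eucl n)) [DiscreteTopology M] (h : 𝓢(Eucl n, ℂ))
    (R : ℝ) (p : ℕ) : ∃ a : M → ℝ, (∀ μ, 0 ≤ a μ) ∧
      (Summable fun μ : M => (1 + ‖(μ : Eucl n)‖) ^ p * a μ) ∧
      ∀ (μ : M) (x : Eucl n), ‖x‖ ≤ R → ‖h (x + μ)‖ ≤ a μ := by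
  obtain ⟨C, hC, hd⟩ := exists_decay h (p + (Module.finrank ℤ M + 1))
  obtain ⟨N, hN⟩ : ∃ N, N = Module.finrank ℤ M + 1 := ⟨_, rfl⟩
  rw [← hN] at hd
  refine ⟨fun μ => C * (1 + |R|) ^ (p + N) * ((1 + ‖(μ : Eucl n)‖) ^ (p + N))⁻¹,
    fun μ => by positivity, ?_, fun μ x hx => ?_⟩
  · refine ((summable_inv_one_add_norm_pow M (N := N) (by omega)).mul_left
      (C * (1 + |R|) ^ (p + N))).congr fun μ => ?_
    have : (1 + ‖(μ : Eucl n)‖) ≠ 0 := by positivity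
    beta_reduce
    rw [pow_add (1 + ‖(μ : Eucl n)‖)]
    field_simp
  · beta_reduce
    rw [← div_eq_mul_inv, le_div_iff₀ (by positivity)]
    have h1 : 1 + ‖(μ : Eucl n)‖ ≤ (1 + |R|) * (1 + ‖x + μ‖) := by
      have : ‖(μ : Eucl n)‖ ≤ ‖x + μ‖ + ‖x‖ := by
        simpa using norm_sub_le (x + (μ : Eucl n)) x
      nlinarith [le_abs_self R, norm_nonneg (x + (μ : Eucl n)), abs_nonneg R]
    calc ‖h (x + μ)‖ * (1 + ‖(μ : Eucl n)‖) ^ (p + N)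
        ≤ ‖h (x + μ)‖ * ((1 + |R|) * (1 + ‖x + μ‖)) ^ (p + N) := by gcongr
      _ = ((1 + ‖x + μ‖) ^ (p + N) * ‖h (x + μ)‖) * (1 + |R|) ^ (p + N) := by rw [mul_pow]; ring
      _ ≤ _ := by gcongr; exact hd _

/-! ### The fundamental domain -/

variable (b) in
theorem exists_norm_le_fundamentalDomain : ∃ R : ℝ, 0 ≤ R ∧
    ∀ x ∈ ZSpan.fundamentalDomain b, ‖x‖ ≤ R := by
  obtain ⟨R, hR⟩ := (ZSpan.fundamentalDomain_isBounded b).exists_norm_le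
  exact ⟨|R|, abs_nonneg R, fun x hx => (hR x hx).trans (le_abs_self R)⟩

variable (b) in
theorem measurableSet_fundamentalDomain : MeasurableSet (ZSpan.fundamentalDomain b) :=
  ZSpan.fundamentalDomain_measurableSet b

variable (b) in
theorem volume_fundamentalDomain_lt_top : volume (ZSpan.fundamentalDomain b) < ⊤ :=
  (ZSpan.fundamentalDomain_isBounded b).measure_lt_top

variable (b) in
theorem volumeReal_fundamentalDomain_ne_zero :
    ((volume.real (ZSpan.fundamentalDomain b) : ℝ) : ℂ) ≠ 0 := by
  rw [Complex.ofReal_ne_zero, measureReal_def, ENNReal.toReal_ne_zero]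
  exact ⟨ZSpan.measure_fundamentalDomain_ne_zero b, (volume_fundamentalDomain_lt_top b).ne⟩

theorem integrableOn_of_isBounded {g : Eucl n → ℂ} (hg : LocallyIntegrable g volume)
    {s : Set (Eucl n)} (hs : Bornology.IsBounded s) : IntegrableOn g s := by
  obtain ⟨R, hR⟩ := hs.subset_closedBall 0
  exact (hg.integrableOn_isCompact (isCompact_closedBall 0 R)).mono_set hR

theorem integrableOn_fundamentalDomain {g : Eucl n → ℂ} (hg : LocallyIntegrable g volume) :
    IntegrableOn g (ZSpan.fundamentalDomain b) :=
  integrableOn_of_isBounded hg (ZSpan.fundamentalDomain_isBounded b)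

/-! ### Unfolding -/

instance (M : Submodule ℤ (Eucl n)) : VAddInvariantMeasure M (Eucl n) volume :=
  inferInstanceAs (VAddInvariantMeasure M.toAddSubgroup (Eucl n) volume)

instance (M : Submodule ℤ (Eucl n)) : MeasurableConstVAdd M (Eucl n) :=
  inferInstanceAs (MeasurableConstVAdd M.toAddSubgroup (Eucl n))

/-- Almost everywhere invariance under the lattice spanned by `b`. -/
def AEPeriodic (b : Module.Basis (Fin n) ℝ (Eucl n)) (w : Eucl n → ℂ) : Prop :=
  ∀ μ : Submodule.span ℤ (Set.range b), ∀ᵐ x, w (x + μ) = w x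

theorem AEPeriodic.integrable_mul_schwartz {w : Eucl n → ℂ} (hw : LocallyIntegrable w volume)
    (hp : AEPeriodic b w) (h : 𝓢(Eucl n, ℂ)) : Integrable fun x => w x * h x := by
  refine ⟨hw.aestronglyMeasurable.mul h.continuous.aestronglyMeasurable, ?_⟩
  obtain ⟨R, -, hR⟩ := exists_norm_le_fundamentalDomain b
  obtain ⟨a, ha0, ha, hab⟩ := exists_summable_bound (Submodule.span ℤ (Set.range b)) h R 0
  simp only [pow_zero, one_mul] at ha
  rw [HasFiniteIntegral, (ZSpan.isAddFundamentalDomain b volume).lintegral_eq_tsum'']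
  have hI := (integrableOn_fundamentalDomain (b := b) hw).2
  have key : ∀ μ : Submodule.span ℤ (Set.range b),
      ∫⁻ x in ZSpan.fundamentalDomain b, ‖w (μ +ᵥ x) * h (μ +ᵥ x)‖ₑ ≤
        ENNReal.ofReal (a μ) * ∫⁻ x in ZSpan.fundamentalDomain b, ‖w x‖ₑ := by
    intro μ
    rw [← lintegral_const_mul' _ _ ENNReal.ofReal_ne_top]
    refine lintegral_mono_ae ?_
    filter_upwards [ae_restrict_of_ae (hp μ), ae_restrict_mem (measurableSet_fundamentalDomain b)]
      with x hx hxI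
    have hv : μ +ᵥ x = x + (μ : Eucl n) := add_comm _ _
    rw [hv, hx, enorm_mul, mul_comm]
    gcongr
    rw [← ofReal_norm]
    exact ENNReal.ofReal_le_ofReal (hab μ x (hR x hxI))
  refine (ENNReal.tsum_le_tsum key).trans_lt ?_
  rw [ENNReal.tsum_mul_right]
  exact ENNReal.mul_lt_top ha.tsum_ofReal_lt_top hI

/-- Unfolding: tile ℝⁿ by lattice translates of I, use the periodicity of w on each tile, and
exchange sum and integral by the summable bound on h. -/
theorem AEPeriodic.integral_mul_schwartz {w : Eucl n → ℂ} (hw : LocallyIntegrable w volume)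
    (hp : AEPeriodic b w) (h : 𝓢(Eucl n, ℂ)) :
    ∫ x, w x * h x = ∫ x in ZSpan.fundamentalDomain b,
      w x * ∑' μ : Submodule.span ℤ (Set.range b), h (x + μ) := by
  obtain ⟨R, -, hR⟩ := exists_norm_le_fundamentalDomain b
  obtain ⟨a, ha0, ha, hab⟩ := exists_summable_bound (Submodule.span ℤ (Set.range b)) h R 0
  simp only [pow_zero, one_mul] at ha
  have hI := integrableOn_fundamentalDomain (b := b) hw
  have hcont : ∀ μ : Submodule.span ℤ (Set.range b), Continuous fun x => h (x + (μ : Eucl n)) :=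
    fun μ => h.continuous.comp (continuous_add_const _)
  have hae : ∀ μ : Submodule.span ℤ (Set.range b), ∀ᵐ x ∂(volume.restrict (ZSpan.fundamentalDomain b)),
      ‖h (x + (μ : Eucl n))‖ ≤ a μ := fun μ => by
    filter_upwards [ae_restrict_mem (measurableSet_fundamentalDomain b)] with x hx
    exact hab μ x (hR x hx)
  have hint : ∀ μ : Submodule.span ℤ (Set.range b), IntegrableOn (fun x => w x * h (x + (μ : Eucl n)))
      (ZSpan.fundamentalDomain b) := fun μ =>
    hI.mul_bdd (hcont μ).aestronglyMeasurable (hae μ)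
  rw [(ZSpan.isAddFundamentalDomain b volume).integral_eq_tsum'' _
    (hp.integrable_mul_schwartz hw h)]
  simp only [← tsum_mul_left]
  rw [← (hasSum_integral_of_summable_integral_norm hint ?_).tsum_eq]
  · refine tsum_congr fun μ => integral_congr_ae ?_
    filter_upwards [ae_restrict_of_ae (hp μ)] with x hx
    have hv : μ +ᵥ x = x + (μ : Eucl n) := add_comm _ _
    rw [hv, hx]
  · refine Summable.of_nonneg_of_le (fun μ => integral_nonneg fun x => norm_nonneg _) (fun μ => ?_)
      (ha.mul_right (∫ x in ZSpan.fundamentalDomain b, ‖w x‖))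
    rw [← integral_const_mul]
    refine integral_mono_ae (hint μ).norm (hI.norm.const_mul _) ?_
    filter_upwards [hae μ] with x hx
    simp only [norm_mul]
    rw [mul_comm]
    gcongr

/-! ### Orthogonality and completeness of characters -/

theorem aePeriodic_character (hb : Submodule.span ℤ (Set.range b) = dualLattice Λ) {l : Eucl n}
    (hl : l ∈ Λ) : AEPeriodic b (character l) := fun μ => ae_of_all _ fun x => by
  have hμ : (μ : Eucl n) ∈ dualLattice Λ := hb ▸ μ.2
  rw [character_add_right, character_eq_one_of_mem hl hμ, mul_one]

theorem setIntegral_character (hb : Submodule.span ℤ (Set.range b) = dualLattice Λ) {l : Eucl n}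
    (hl : l ∈ Λ) (hl0 : l ≠ 0) : ∫ x in ZSpan.fundamentalDomain b, character l x = 0 := by
  have hnorm : ‖l‖ ≠ 0 := norm_ne_zero_iff.2 hl0
  -- Translation by y multiplies the character by −1, while the integral over a fundamental domain
  -- is unchanged, so it equals its own negative.
  set y : Eucl n := (1 / (2 * ‖l‖ ^ 2)) • l with hy
  have hly : character l y = -1 := by
    have : ⟪l, y⟫_ℝ = 1 / 2 := by
      rw [hy, inner_smul_right, real_inner_self_eq_norm_sq]
      field_simp
    rw [character_eq, this, ← Complex.exp_pi_mul_I]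
    congr 2; push_cast; ring
  have hD := ZSpan.isAddFundamentalDomain b volume
  have h1 := hD.setIntegral_eq (hD.vadd_of_comm y) (f := character l) (fun μ x => by
    have hμ : (μ : Eucl n) ∈ dualLattice Λ := hb ▸ μ.2
    rw [show μ +ᵥ x = (μ : Eucl n) + x from rfl, character_add_right,
      character_eq_one_of_mem hl hμ, one_mul])
  have h2 : ∫ x in y +ᵥ ZSpan.fundamentalDomain b, character l x =
      ∫ x in ZSpan.fundamentalDomain b, character l (y +ᵥ x) :=
    (measurePreserving_vadd y volume).setIntegral_image_emb (measurableEmbedding_const_vadd y) _ _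
  rw [h2] at h1
  simp only [vadd_eq_add, character_add_right, hly, integral_const_mul] at h1
  have h3 : (2 : ℂ) * ∫ x in ZSpan.fundamentalDomain b, character l x = 0 := by
    linear_combination h1
  simpa using h3

variable (b) in
/-- The quotient map of `ℝⁿ` by the lattice spanned by `b`, in coordinates. -/
def torusMap (x : Eucl n) : UnitAddTorus (Fin n) := fun i => ((b.repr x i : ℝ) : UnitAddCircle)

theorem isQuotientMap_torusMap : IsQuotientMap (torusMap b) := by
  have h1 : IsOpenQuotientMap (Pi.map fun (_ : Fin n) (t : ℝ) => (t : UnitAddCircle)) :=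
    IsOpenQuotientMap.piMap fun _ => QuotientAddGroup.isOpenQuotientMap_mk
  exact h1.isQuotientMap.comp b.equivFunL.toHomeomorph.isQuotientMap

theorem sub_mem_of_torusMap_eq {x y : Eucl n} (h : torusMap b x = torusMap b y) :
    x - y ∈ Submodule.span ℤ (Set.range b) := by
  rw [b.mem_span_iff_repr_mem ℤ]
  intro i
  have hi : ((b.repr x i : ℝ) : UnitAddCircle) = ((b.repr y i : ℝ) : UnitAddCircle) := congrFun h i
  have h2 : ((b.repr x i - b.repr y i : ℝ) : UnitAddCircle) = 0 := by
    rw [AddCircle.coe_sub, hi, sub_self]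
  obtain ⟨k, hk⟩ := AddCircle.coe_eq_zero_iff 1 |>.1 h2
  exact ⟨k, by simpa using hk⟩

/-- The frequency l is the vector with ⟪l, b i⟫ = m i; it lies in Λ by biduality. -/
theorem mFourier_torusMap [DiscreteTopology Λ] [IsZLattice ℝ Λ]
    (hb : Submodule.span ℤ (Set.range b) = dualLattice Λ) (m : Fin n → ℤ) :
    ∃ l ∈ Λ, ∀ x, UnitAddTorus.mFourier m (torusMap b x) = character l x := by
  let T : Eucl n →ₗ[ℝ] ℝ := b.constr ℝ fun i => (m i : ℝ)
  let l : Eucl n := (InnerProductSpace.toDual ℝ (Eucl n)).symm (LinearMap.toContinuousLinearMap T)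
  have hl : ∀ x, ⟪l, x⟫_ℝ = T x := fun x => by simp [l]
  refine ⟨l, mem_of_inner_basis_eq_int hb fun i => ⟨m i, by rw [hl]; simp [T]⟩, fun x => ?_⟩
  have h1 : T x = ∑ i, b.repr x i * (m i : ℝ) := by
    simp [T, Module.Basis.constr_apply_fintype, Module.Basis.equivFun_apply]
  rw [character_eq, hl, h1]
  simp only [UnitAddTorus.mFourier, ContinuousMap.coe_mk, torusMap, fourier_coe_apply]
  rw [← Complex.exp_sum]
  congr 1
  push_cast
  rw [Finset.mul_sum, Finset.sum_mul]
  refine Finset.sum_congr rfl fun i _ => ?_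
  simp
  ring

/-- G descends to a continuous function on the torus. The continuous functional q ↦ ∫_I G q kills
the trigonometric monomials, whose span is dense, hence it kills the conjugate of G. So ∫_I |G|² =
0. -/
theorem eq_zero_of_forall_setIntegral_character [DiscreteTopology Λ] [IsZLattice ℝ Λ]
    (hb : Submodule.span ℤ (Set.range b) = dualLattice Λ) {G : Eucl n → ℂ} (hG : Continuous G)
    (hper : ∀ μ ∈ Submodule.span ℤ (Set.range b), ∀ x, G (x + μ) = G x)
    (h : ∀ l ∈ Λ, ∫ x in ZSpan.fundamentalDomain b, G x * character l x = 0) (x : Eucl n) :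
    G x = 0 := by
  have hfac : ∀ x y, torusMap b x = torusMap b y → G x = G y := fun x y hxy => by
    have := hper _ (sub_mem_of_torusMap_eq hxy) y
    rwa [add_sub_cancel] at this
  have hcont : Continuous (torusMap b) := isQuotientMap_torusMap.continuous
  let τ : C(Eucl n, UnitAddTorus (Fin n)) := ⟨torusMap b, hcont⟩
  have hτ : IsQuotientMap τ := isQuotientMap_torusMap
  let g : C(UnitAddTorus (Fin n), ℂ) := hτ.lift ⟨G, hG⟩ (fun x y hxy => hfac x y hxy)
  have hg : ∀ x, g (torusMap b x) = G x := fun x =>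
    congrFun (congrArg DFunLike.coe (hτ.lift_comp ⟨G, hG⟩ (fun x y hxy => hfac x y hxy))) x
  have hI : ∀ w : Eucl n → ℂ, Continuous w → IntegrableOn w (ZSpan.fundamentalDomain b) :=
    fun w hw => integrableOn_fundamentalDomain hw.locallyIntegrable
  let T : C(UnitAddTorus (Fin n), ℂ) →ₗ[ℂ] ℂ :=
    { toFun := fun q => ∫ x in ZSpan.fundamentalDomain b, G x * q (torusMap b x)
      map_add' := fun q r => by
        simp only [ContinuousMap.add_apply, mul_add]
        exact integral_add (hI _ (by fun_prop)) (hI _ (by fun_prop))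
      map_smul' := fun a q => by
        simp only [ContinuousMap.smul_apply, smul_eq_mul, RingHom.id_apply]
        rw [← integral_const_mul]
        congr 1; ext x; ring }
  let T' : C(UnitAddTorus (Fin n), ℂ) →L[ℂ] ℂ := T.mkContinuous
    (∫ x in ZSpan.fundamentalDomain b, ‖G x‖) fun q => by
      refine (norm_integral_le_integral_norm _).trans ?_
      rw [← integral_mul_const]
      refine integral_mono (hI _ (by fun_prop)).norm ((hI _ hG).norm.mul_const _) fun x => ?_
      simp only [norm_mul]
      gcongr
      exact q.norm_coe_le_norm _
  have hker : (⊤ : Submodule ℂ C(UnitAddTorus (Fin n), ℂ)) ≤ LinearMap.ker T'.toLinearMap := by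
    rw [← UnitAddTorus.span_mFourier_closure_eq_top]
    refine Submodule.topologicalClosure_minimal _ ?_ T'.isClosed_ker
    rw [Submodule.span_le]
    rintro _ ⟨m, rfl⟩
    obtain ⟨l, hl, hlx⟩ := mFourier_torusMap hb m
    change ∫ x in ZSpan.fundamentalDomain b, G x * UnitAddTorus.mFourier m (torusMap b x) = 0
    simp only [hlx]
    exact h l hl
  have h0 : ∫ x in ZSpan.fundamentalDomain b, G x * star (G x) = 0 := by
    have : T' (star g) = 0 := hker (Submodule.mem_top (x := star g))
    change ∫ x in ZSpan.fundamentalDomain b, G x * star (g (torusMap b x)) = 0 at this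
    simpa only [hg] using this
  have h1 : ∫ x in ZSpan.fundamentalDomain b, ‖G x‖ ^ 2 = 0 := by
    rw [← Complex.ofReal_eq_zero, ← integral_complex_ofReal, ← h0]
    congr 1; ext x
    rw [Complex.star_def, Complex.mul_conj, Complex.normSq_eq_norm_sq]
  have hsq : IntegrableOn (fun x => ‖G x‖ ^ 2) (ZSpan.fundamentalDomain b) := by
    rw [IntegrableOn]
    simpa using (hI (fun x => ((‖G x‖ ^ 2 : ℝ) : ℂ)) (by fun_prop)).re
  rw [integral_eq_zero_iff_of_nonneg (fun x => by positivity) hsq] at h1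
  rw [Filter.EventuallyEq, ae_restrict_iff' (measurableSet_fundamentalDomain b)] at h1
  -- Countably many lattice translates carry the vanishing from I to almost all of ℝⁿ; continuity
  -- then removes the exceptional null set.
  have h2 : ∀ᵐ x : Eucl n, ∀ μ : Submodule.span ℤ (Set.range b),
      (x + (μ : Eucl n) ∈ ZSpan.fundamentalDomain b → G (x + (μ : Eucl n)) = 0) := by
    rw [ae_all_iff]
    intro μ
    have := (measurePreserving_add_right volume (μ : Eucl n)).quasiMeasurePreserving.ae h1
    filter_upwards [this] with x hx hxI
    simpa using hx hxI
  have h3 : G =ᵐ[volume] 0 := by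
    filter_upwards [h2] with x hx
    obtain ⟨μ, hμ, -⟩ := ZSpan.exist_unique_vadd_mem_fundamentalDomain b x
    have hv : μ +ᵥ x = x + (μ : Eucl n) := add_comm _ _
    rw [hv] at hμ
    rw [← hper μ μ.2 x, hx μ hμ]
    rfl
  exact congrFun ((hG.ae_eq_iff_eq volume continuous_zero).1 h3) x

end Lattice

/-! ### The Poisson summation formula -/

section Poisson

variable {Λ : Submodule ℤ (Eucl n)} {b : Module.Basis (Fin n) ℝ (Eucl n)}

theorem continuous_periodization (M : Submodule ℤ (Eucl n)) [DiscreteTopology M]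
    (h : 𝓢(Eucl n, ℂ)) : Continuous fun x => ∑' μ : M, h (x + μ) := by
  rw [continuous_iff_continuousAt]
  intro x
  obtain ⟨a, -, ha, hab⟩ := exists_summable_bound M h (‖x‖ + 1) 0
  simp only [pow_zero, one_mul] at ha
  have : ContinuousOn (fun x => ∑' μ : M, h (x + μ)) {y | ‖y‖ < ‖x‖ + 1} :=
    continuousOn_tsum (fun μ => (h.continuous.comp (continuous_add_const _)).continuousOn) ha
      fun μ y hy => hab μ y (le_of_lt hy)
  exact this.continuousAt ((isOpen_lt continuous_norm continuous_const).mem_nhds (by simp))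

theorem periodization_add (M : Submodule ℤ (Eucl n)) (h : 𝓢(Eucl n, ℂ)) {ν : Eucl n} (hν : ν ∈ M)
    (x : Eucl n) : ∑' μ : M, h (x + ν + μ) = ∑' μ : M, h (x + μ) := by
  rw [← (Equiv.addLeft (⟨ν, hν⟩ : M)).tsum_eq (fun μ : M => h (x + μ))]
  refine tsum_congr fun μ => ?_
  simp [add_assoc]

theorem finite_support_lattice [DiscreteTopology Λ] {k : Eucl n → ℂ} (hk : HasCompactSupport k) :
    (Function.support fun l : Λ => k l).Finite := by
  have hΛ : IsClosed (Λ : Set (Eucl n)) :=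
    @AddSubgroup.isClosed_of_discrete _ _ _ _ _ Λ.toAddSubgroup ‹_›
  have hfin := Metric.finite_isBounded_inter_isClosed (s := (Λ : Set (Eucl n)))
    DiscreteTopology.isDiscrete (IsCompact.isBounded hk) hΛ
  refine (hfin.preimage (f := ((↑) : Λ → Eucl n)) Subtype.val_injective.injOn).subset ?_
  exact fun l hl => ⟨subset_tsupport _ hl, l.2⟩

/-- Poisson summation. Both sides are continuous and Λ^⊥-periodic, so comparing integrals against
characters suffices: unfolding and Fourier inversion give k(l) on the left, orthogonality gives k(l)
on the right. Compact support of k makes the right side a finite sum. -/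
theorem tsum_fourier_eq [DiscreteTopology Λ] [IsZLattice ℝ Λ]
    (hb : Submodule.span ℤ (Set.range b) = dualLattice Λ) {k : 𝓢(Eucl n, ℂ)}
    (hk : HasCompactSupport k) (x : Eucl n) :
    ∑' μ : Submodule.span ℤ (Set.range b), 𝓕 k (x + μ) =
      ((volume.real (ZSpan.fundamentalDomain b) : ℝ) : ℂ)⁻¹ *
        ∑ l ∈ (finite_support_lattice (Λ := Λ) hk).toFinset, k l * character (-(l : Eucl n)) x := by
  set S := (finite_support_lattice (Λ := Λ) hk).toFinset with hS
  set V := ((volume.real (ZSpan.fundamentalDomain b) : ℝ) : ℂ) with hV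
  have hV0 : V ≠ 0 := volumeReal_fundamentalDomain_ne_zero b
  rw [← sub_eq_zero]
  have hcont1 := continuous_periodization (Submodule.span ℤ (Set.range b)) (𝓕 k)
  have hcharc : ∀ l : Eucl n, Continuous (character l) := continuous_character
  have hI : ∀ w : Eucl n → ℂ, Continuous w → IntegrableOn w (ZSpan.fundamentalDomain b) :=
    fun w hw => integrableOn_fundamentalDomain hw.locallyIntegrable
  refine eq_zero_of_forall_setIntegral_character (Λ := Λ) hb (G := fun x =>
    ∑' μ : Submodule.span ℤ (Set.range b), 𝓕 k (x + μ) -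
      V⁻¹ * ∑ l ∈ S, k l * character (-(l : Eucl n)) x)
    (hcont1.sub (by fun_prop)) (fun μ hμ x => ?_) (fun l hl => ?_) x
  · have hc : ∀ l : Λ, character (-(l : Eucl n)) (x + μ) = character (-(l : Eucl n)) x := fun l => by
      have hμ' : μ ∈ dualLattice Λ := hb ▸ hμ
      rw [character_add_right, character_eq_one_of_mem (neg_mem l.2) hμ', mul_one]
    simp only [hc, periodization_add _ _ hμ]
  · simp only [sub_mul]
    rw [integral_sub (hI (fun x => (∑' μ : Submodule.span ℤ (Set.range b), 𝓕 k (x + μ)) *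
        character l x) (hcont1.mul (hcharc l))) (hI (fun x => (V⁻¹ * ∑ l ∈ S, k l *
        character (-(l : Eucl n)) x) * character l x) (by fun_prop)), sub_eq_zero]
    have h1 := (aePeriodic_character hb hl).integral_mul_schwartz
      (hcharc l).locallyIntegrable (𝓕 k)
    rw [← fourierInv_apply_eq', FourierTransform.fourierInv_fourier_eq] at h1
    simp only [mul_comm _ (character l _)]
    rw [← h1]
    have h2 : ∀ x, character l x * (V⁻¹ * ∑ m ∈ S, k m * character (-(m : Eucl n)) x) =
        ∑ m ∈ S, V⁻¹ * k m * character (l - (m : Eucl n)) x := fun x => by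
      rw [Finset.mul_sum, Finset.mul_sum]
      refine Finset.sum_congr rfl fun m _ => ?_
      rw [sub_eq_add_neg, character_add_left]; ring
    simp only [h2]
    rw [integral_finsetSum _ fun m _ => hI _ (by fun_prop)]
    simp only [integral_const_mul]
    rw [Finset.sum_eq_single (⟨l, hl⟩ : Λ)]
    · have : ∫ x in ZSpan.fundamentalDomain b, character (l - l) x = V := by
        simp [hV]
      simp only [this]
      field_simp
    · intro m _ hm
      rw [setIntegral_character hb (sub_mem hl m.2), mul_zero]
      intro h0
      exact hm (Subtype.ext (sub_eq_zero.1 h0).symm)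
    · intro hm
      have : k l = 0 := by simpa [hS] using hm
      simp [this]

/-- The Fourier coefficient of a locally integrable periodic function. -/
def functionCoefficient (b : Module.Basis (Fin n) ℝ (Eucl n)) (w : Eucl n → ℂ) (l : Eucl n) : ℂ :=
  ((volume.real (ZSpan.fundamentalDomain b) : ℝ) : ℂ)⁻¹ *
    ∫ x in ZSpan.fundamentalDomain b, w x * character (-l) x

/-- Unfold the integral and insert Poisson summation for 𝓕k; this says that w is its Fourier series
in the distributional sense, with no convergence question. -/
theorem AEPeriodic.integral_mul_fourier [DiscreteTopology Λ] [IsZLattice ℝ Λ]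
    (hb : Submodule.span ℤ (Set.range b) = dualLattice Λ) {w : Eucl n → ℂ}
    (hw : LocallyIntegrable w volume) (hp : AEPeriodic b w) {k : 𝓢(Eucl n, ℂ)}
    (hk : HasCompactSupport k) :
    ∫ x, w x * 𝓕 k x = ∑ᶠ l : Λ, functionCoefficient b w l * k l := by
  rw [hp.integral_mul_schwartz hw]
  simp only [tsum_fourier_eq hb hk]
  rw [finsum_eq_sum_of_support_subset (s := (finite_support_lattice (Λ := Λ) hk).toFinset) _ (by
    intro l hl
    simp only [Set.Finite.coe_toFinset, Function.mem_support] at hl ⊢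
    exact right_ne_zero_of_mul hl)]
  have hI : ∀ l : Eucl n, IntegrableOn (fun x => w x * character l x) (ZSpan.fundamentalDomain b) :=
    fun l => (integrableOn_fundamentalDomain hw).mul_bdd (c := 1)
      (continuous_character l).aestronglyMeasurable (ae_of_all _ fun x => (norm_character l x).le)
  have h1 : ∀ x, w x * (((volume.real (ZSpan.fundamentalDomain b) : ℝ) : ℂ)⁻¹ *
        ∑ l ∈ (finite_support_lattice (Λ := Λ) hk).toFinset, k l * character (-(l : Eucl n)) x) =
      ∑ l ∈ (finite_support_lattice (Λ := Λ) hk).toFinset,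
        (((volume.real (ZSpan.fundamentalDomain b) : ℝ) : ℂ)⁻¹ * k l) *
          (w x * character (-(l : Eucl n)) x) := fun x => by
    rw [Finset.mul_sum, Finset.mul_sum]
    exact Finset.sum_congr rfl fun m _ => by ring
  simp only [h1]
  rw [integral_finsetSum _ fun l _ => (hI _).const_mul _]
  refine Finset.sum_congr rfl fun l _ => ?_
  rw [integral_const_mul, functionCoefficient]
  ring

/-! ### Non-vanishing of the Fourier transform of the window on cosets of the dual lattice -/

/-- If ψ vanished on x + Λ^⊥, Poisson summation for t ↦ χ(s − t) would give ∑ χ(s − l) e^{−2πi l·x}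
= 0. When χ(s) ≠ 0, disjointness of the l + U leaves only the term l = 0, a contradiction. -/
theorem exists_fourier_reflect_ne_zero [DiscreteTopology Λ] [IsZLattice ℝ Λ]
    (hb : Submodule.span ℤ (Set.range b) = dualLattice Λ) {U : Opens (Eucl n)}
    (hUd : Pairwise fun l l' : Λ =>
      Disjoint ((fun x => (l : Eucl n) + x) '' (U : Set (Eucl n)))
        ((fun x => (l' : Eucl n) + x) '' (U : Set (Eucl n))))
    {χ : 𝓓(U, ℂ)} (hχ : χ ≠ 0) (x : Eucl n) :
    ∃ μ : Submodule.span ℤ (Set.range b), 𝓕 (reflect χ) (x + μ) ≠ 0 := by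
  by_contra! hcon
  apply hχ
  have hsupp : ∀ t, χ t ≠ 0 → t ∈ U := fun t ht => χ.tsupport_subset (subset_tsupport _ ht)
  ext s
  by_contra hs
  have hs' : χ s ≠ 0 := hs
  let k : 𝓢(Eucl n, ℂ) := SchwartzMap.compSubConstCLM ℂ s (reflect χ)
  have hk : HasCompactSupport k :=
    (hasCompactSupport_reflect χ).comp_homeomorph (Homeomorph.subRight s)
  have hkl : ∀ l, k l = χ (s - l) := fun l => by simp [k]
  have h1 := tsum_fourier_eq hb hk x
  have h2 : ∀ μ : Submodule.span ℤ (Set.range b), 𝓕 k (x + μ) = 0 := fun μ => by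
    rw [fourier_compSubConst, hcon μ, mul_zero]
  simp only [h2, tsum_zero] at h1
  rw [Finset.sum_eq_single (0 : Λ)] at h1
  · have h3 := volumeReal_fundamentalDomain_ne_zero b
    simp [hkl] at h1
    exact h1.elim (fun h => h3 (by simpa using h)) hs'
  · intro l _ hl
    have : χ (s - l) = 0 := by
      by_contra hne
      refine Set.disjoint_left.1 (hUd hl) (show s ∈ _ from ⟨s - l, hsupp _ hne, by simp⟩) (show s ∈ _ from ⟨s, hsupp s hs', by simp⟩)
    simp [hkl, this]
  · intro h0
    have : k ((0 : Λ) : Eucl n) = 0 := by simpa using h0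
    rw [this, zero_mul]

/-- The open sets {ψ(· + μ) ≠ 0} cover a closed ball containing I. A finite subcover gives F, and δ
is the minimum over the ball of the resulting positive continuous sum. -/
theorem exists_finset_le_sum_norm_sq [DiscreteTopology Λ] [IsZLattice ℝ Λ]
    (hb : Submodule.span ℤ (Set.range b) = dualLattice Λ) {U : Opens (Eucl n)}
    (hUd : Pairwise fun l l' : Λ =>
      Disjoint ((fun x => (l : Eucl n) + x) '' (U : Set (Eucl n)))
        ((fun x => (l' : Eucl n) + x) '' (U : Set (Eucl n))))
    {χ : 𝓓(U, ℂ)} (hχ : χ ≠ 0) :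
    ∃ F : Finset (Submodule.span ℤ (Set.range b)), ∃ δ > 0, ∀ x ∈ ZSpan.fundamentalDomain b,
      δ ≤ ∑ μ ∈ F, ‖𝓕 (reflect χ) (x + μ)‖ ^ 2 := by
  obtain ⟨R, hR0, hR⟩ := exists_norm_le_fundamentalDomain b
  have hK : IsCompact (Metric.closedBall (0 : Eucl n) R) := isCompact_closedBall 0 R
  have hc : ∀ μ : Submodule.span ℤ (Set.range b),
      Continuous fun x => 𝓕 (reflect χ) (x + (μ : Eucl n)) := fun μ =>
    (𝓕 (reflect χ)).continuous.comp (continuous_add_const _)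
  obtain ⟨F, hF⟩ := hK.elim_finite_subcover
    (fun μ : Submodule.span ℤ (Set.range b) => {x | 𝓕 (reflect χ) (x + (μ : Eucl n)) ≠ 0})
    (fun μ => isOpen_ne_fun (hc μ) continuous_const)
    (fun x _ => by
      obtain ⟨μ, hμ⟩ := exists_fourier_reflect_ne_zero hb hUd hχ x
      exact mem_iUnion.2 ⟨μ, hμ⟩)
  have hcs : Continuous fun x => ∑ μ ∈ F, ‖𝓕 (reflect χ) (x + (μ : Eucl n))‖ ^ 2 :=
    continuous_finsetSum _ fun μ _ => (hc μ).norm.pow 2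
  obtain ⟨x₀, hx₀, hmin⟩ := hK.exists_isMinOn ⟨0, by simpa using hR0⟩ hcs.continuousOn
  refine ⟨F, _, ?_, fun x hx => hmin (by simpa using hR x hx)⟩
  obtain ⟨μ, hμF, hμ⟩ := mem_iUnion₂.1 (hF hx₀)
  refine lt_of_lt_of_le ?_ (Finset.single_le_sum (f := fun μ : Submodule.span ℤ (Set.range b) =>
    ‖𝓕 (reflect χ) (x₀ + (μ : Eucl n))‖ ^ 2) (fun _ _ => by positivity) hμF)
  have : 0 < ‖𝓕 (reflect χ) (x₀ + (μ : Eucl n))‖ := norm_pos_iff.2 hμ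
  positivity

end Poisson

section Spaces

variable {E : Type u} [NormedAddCommGroup E] [NormedSpace ℂ E] {ι : E →L[ℂ] Temp n}

/-! ### Translations -/

/-- `T_x E ⊆ E` with norms bounded by `C (1 + |x|) ^ p`. -/
def TranslationBound (ι : E →L[ℂ] Temp n) (C : ℝ) (p : ℕ) : Prop :=
  ∀ (x : Eucl n) (e : E), ∃ e' : E, ι e' = translation x (ι e) ∧ ‖e'‖ ≤ C * (1 + ‖x‖) ^ p * ‖e‖

theorem IsTMIB.exists_translationBound (h : IsTMIB ι) : ∃ C, 0 ≤ C ∧ ∃ p, TranslationBound ι C p := by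
  obtain ⟨C, hC, τ, -, hT⟩ := h.translation
  refine ⟨C, hC.le, ⌈τ⌉₊, fun x e => ?_⟩
  obtain ⟨e', he', hn⟩ := hT x e
  refine ⟨e', he', hn.trans ?_⟩
  rw [← Real.rpow_natCast]
  gcongr
  · linarith [norm_nonneg x]
  · exact Nat.le_ceil τ

theorem translation_toTemperedDistribution (x : Eucl n) (φ : 𝓢(Eucl n, ℂ)) :
    translation x (SchwartzMap.toTemperedDistributionCLM (Eucl n) ℂ volume φ) =
      SchwartzMap.toTemperedDistributionCLM (Eucl n) ℂ volume
        (SchwartzMap.compSubConstCLM ℂ x φ) := by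
  ext η
  rw [translation_apply]
  have h : ∀ f g : 𝓢(Eucl n, ℂ), SchwartzMap.toTemperedDistributionCLM (Eucl n) ℂ volume f g =
      ∫ t, g t • f t := SchwartzMap.toTemperedDistributionCLM_apply_apply volume
  rw [h, h, ← integral_sub_right_eq_self _ x]
  simp

/-- T_x on the dual is the transpose of T_{−x} on the predual. The norms of `Φ` and its inverse
enter the constant because `Φ` is only a topological isomorphism. -/
theorem IsDTMIB.exists_translationBound (h : IsDTMIB.{u, v} ι) :
    ∃ C, 0 ≤ C ∧ ∃ p, TranslationBound ι C p := by
  obtain ⟨E₀, _, _, _, ι₀, Φ, h₀, hΦ⟩ := h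
  obtain ⟨C, hC, p, hT⟩ := h₀.exists_translationBound
  obtain ⟨j, hj, -⟩ := h₀.schwartz
  choose τ hτ hτn using hT
  -- The chosen preimages depend linearly on the vector because `ι₀` is injective.
  let T : Eucl n → E₀ →L[ℂ] E₀ := fun x => LinearMap.mkContinuous
    { toFun := τ x
      map_add' := fun a b => h₀.injective (by simp only [map_add, hτ])
      map_smul' := fun a b => h₀.injective (by simp only [map_smul, hτ, RingHom.id_apply]) }
    (C * (1 + ‖x‖) ^ p) (hτn x)
  have hTn : ∀ x, ‖T x‖ ≤ C * (1 + ‖x‖) ^ p := fun x =>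
    LinearMap.mkContinuous_norm_le _ (by positivity) _
  refine ⟨‖(Φ.symm : StrongDual ℂ E₀ →L[ℂ] E)‖ * ‖(Φ : E →L[ℂ] StrongDual ℂ E₀)‖ * C,
    by positivity, p, fun x e => ⟨Φ.symm ((Φ e).comp (T (-x))), ?_, ?_⟩⟩
  · ext φ
    rw [hΦ _ φ (j φ) (hj φ), Φ.apply_symm_apply, ContinuousLinearMap.comp_apply, translation_apply,
      hΦ e (SchwartzMap.compSubConstCLM ℂ (-x) φ) (T (-x) (j φ))]
    change ι₀ (τ (-x) (j φ)) = _
    rw [hτ, hj, translation_toTemperedDistribution]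
  · calc ‖Φ.symm ((Φ e).comp (T (-x)))‖
        ≤ ‖(Φ.symm : StrongDual ℂ E₀ →L[ℂ] E)‖ * ‖(Φ e).comp (T (-x))‖ :=
          (Φ.symm : StrongDual ℂ E₀ →L[ℂ] E).le_opNorm _
      _ ≤ ‖(Φ.symm : StrongDual ℂ E₀ →L[ℂ] E)‖ *
          ((‖(Φ : E →L[ℂ] StrongDual ℂ E₀)‖ * ‖e‖) * (C * (1 + ‖x‖) ^ p)) := by
          gcongr
          refine (ContinuousLinearMap.opNorm_comp_le _ _).trans ?_
          have h1 := (Φ : E →L[ℂ] StrongDual ℂ E₀).le_opNorm e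
          have h2 := hTn (-x)
          rw [norm_neg] at h2
          gcongr
          exact h1
      _ = _ := by ring

/-! ### Elements of `E` that are functions -/

/-- The locally integrable function `g` is the element `e` of `E`. -/
def RepFun (ι : E →L[ℂ] Temp n) (e : E) (g : Eucl n → ℂ) : Prop :=
  LocallyIntegrable g volume ∧ Represents ι e (ofFun g)

theorem RepFun.zero : RepFun ι 0 0 :=
  ⟨locallyIntegrable_zero, fun φ => by simp [ofFun]⟩

theorem RepFun.add {e e' : E} {f g : Eucl n → ℂ} (hf : RepFun ι e f) (hg : RepFun ι e' g) :
    RepFun ι (e + e') (f + g) := by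
  refine ⟨hf.1.add hg.1, fun φ => ?_⟩
  rw [map_add]
  change ι e φ.toSchwartz + ι e' φ.toSchwartz = _
  rw [hf.2 φ, hg.2 φ, ofFun, ofFun, ofFun, ← integral_add (integrable_mul_test hf.1 φ)
    (integrable_mul_test hg.1 φ)]
  simp [add_mul]

theorem RepFun.smul {e : E} {f : Eucl n → ℂ} (hf : RepFun ι e f) (a : ℂ) : RepFun ι (a • e) (a • f) := by
  refine ⟨hf.1.smul a, fun φ => ?_⟩
  rw [map_smul]
  change a * ι e φ.toSchwartz = _
  rw [hf.2 φ, ofFun, ofFun, ← integral_const_mul]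
  simp [mul_assoc]

theorem RepFun.sum {α : Type*} (F : Finset α) {e : α → E} {f : α → Eucl n → ℂ}
    (h : ∀ a, RepFun ι (e a) (f a)) : RepFun ι (∑ a ∈ F, e a) (∑ a ∈ F, f a) := by
  classical
  induction F using Finset.induction_on with
  | empty => simpa using RepFun.zero
  | insert a F ha ih => rw [Finset.sum_insert ha, Finset.sum_insert ha]; exact (h a).add ih

theorem RepFun.congr {e : E} {f g : Eucl n → ℂ} (h : RepFun ι e f) (hfg : f =ᵐ[volume] g) : RepFun ι e g := by
  refine ⟨h.1.congr hfg, fun φ => ?_⟩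
  rw [h.2 φ]
  exact ofFun_congr hfg φ

theorem RepFun.solid (hs : IsSolid ι) {e : E} {f g : Eucl n → ℂ} (h : RepFun ι e f)
    (hg : AEStronglyMeasurable g volume) {C : ℝ} (hC : 0 ≤ C) (hgf : ∀ᵐ x, ‖g x‖ ≤ C * ‖f x‖) :
    ∃ e', RepFun ι e' g ∧ ‖e'‖ ≤ C * ‖e‖ := by
  have hgl := h.1.of_norm_le hg hgf
  have h' := h.smul (C : ℂ)
  obtain ⟨e', he', hn⟩ := hs.solid _ _ g h'.1 h'.2 hgl (by
    filter_upwards [hgf] with x hx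
    simpa [abs_of_nonneg hC] using hx)
  refine ⟨e', ⟨hgl, he'⟩, hn.trans (le_of_eq ?_)⟩
  rw [norm_smul, Complex.norm_real, Real.norm_of_nonneg hC]

theorem RepFun.translate {C : ℝ} {p : ℕ} (ht : TranslationBound ι C p) {e : E} {g : Eucl n → ℂ}
    (h : RepFun ι e g) (x : Eucl n) :
    ∃ e', RepFun ι e' (fun t => g (t + x)) ∧ ‖e'‖ ≤ C * (1 + ‖x‖) ^ p * ‖e‖ := by
  obtain ⟨e', he', hn⟩ := ht (-x) e
  refine ⟨e', ⟨h.1.comp_add_const x, fun φ => ?_⟩, by simpa using hn⟩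
  have hφ : SchwartzMap.compSubConstCLM ℂ (- -x) φ.toSchwartz = (φ.shift (-x)).toSchwartz := by
    ext t; simp [sub_eq_add_neg]
  rw [he', translation_apply, hφ, h.2, ofFun, ofFun, ← integral_add_right_eq_self _ x]
  simp

/-- Every domination argument below has this shape; the constant depends on F and K only, not on the
functions. -/
theorem exists_rep_of_le_sum_translates (hs : IsSolid ι) {C : ℝ} {p : ℕ} (hC : 0 ≤ C)
    (ht : TranslationBound ι C p) (F : Finset (Eucl n)) {K : ℝ} (hK : 0 ≤ K) :
    ∃ K', 0 ≤ K' ∧ ∀ (e : E) (g w : Eucl n → ℂ), RepFun ι e g → AEStronglyMeasurable w volume →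
      (∀ᵐ x, ‖w x‖ ≤ K * ∑ μ ∈ F, ‖g (x + μ)‖) → ∃ e', RepFun ι e' w ∧ ‖e'‖ ≤ K' * ‖e‖ := by
  refine ⟨K * ∑ μ ∈ F, C * (1 + ‖μ‖) ^ p, by positivity, fun e g w h hw hle => ?_⟩
  -- Replacing g by |g| first makes the sum of translates free of cancellation, so that it dominates
  -- w.
  have hnorm : AEStronglyMeasurable (fun x => ((‖g x‖ : ℝ) : ℂ)) volume :=
    Complex.continuous_ofReal.comp_aestronglyMeasurable h.1.aestronglyMeasurable.norm
  obtain ⟨e₁, he₁, hn₁⟩ := h.solid hs hnorm zero_le_one (ae_of_all _ fun x => by simp)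
  rw [one_mul] at hn₁
  choose τ hτ hτn using fun μ => he₁.translate ht μ
  have hsum := RepFun.sum F hτ
  obtain ⟨e', he', hn'⟩ := hsum.solid hs hw hK (by
    filter_upwards [hle] with x hx
    refine hx.trans (le_of_eq ?_)
    rw [Finset.sum_apply, ← Complex.ofReal_sum, Complex.norm_real, Real.norm_of_nonneg]
    positivity)
  refine ⟨e', he', hn'.trans ?_⟩
  rw [mul_assoc]
  gcongr
  refine (norm_sum_le _ _).trans ?_
  rw [Finset.sum_mul]
  refine Finset.sum_le_sum fun μ _ => (hτn μ).trans ?_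
  gcongr

/-- For integrable w the functional f ↦ ∫ w f is bounded in the sup norm, hence continuous on 𝓢, and
density of 𝓓 extends the identity from test functions. -/
theorem RepFun.apply_of_integrable {e : E} {w : Eucl n → ℂ} (h : RepFun ι e w) (hw : Integrable w)
    (f : 𝓢(Eucl n, ℂ)) : ι e f = ∫ x, w x * f x := by
  let T : BoundedContinuousFunction (Eucl n) ℂ →ₗ[ℂ] ℂ :=
    { toFun := fun q => ∫ x, w x * q x
      map_add' := fun q r => by
        simp only [BoundedContinuousFunction.add_apply, mul_add]
        exact integral_add (hw.mul_bdd q.continuous.aestronglyMeasurable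
          (ae_of_all _ q.norm_coe_le_norm)) (hw.mul_bdd r.continuous.aestronglyMeasurable
          (ae_of_all _ r.norm_coe_le_norm))
      map_smul' := fun a q => by
        simp only [BoundedContinuousFunction.smul_apply, smul_eq_mul, RingHom.id_apply]
        rw [← integral_const_mul]
        congr 1; ext x; ring }
  let T' := T.mkContinuous (∫ x, ‖w x‖) fun q => by
    refine (norm_integral_le_integral_norm _).trans ?_
    rw [← integral_mul_const]
    refine integral_mono (hw.mul_bdd q.continuous.aestronglyMeasurable
      (ae_of_all _ q.norm_coe_le_norm)).norm (hw.norm.mul_const _) fun x => ?_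
    simp only [norm_mul]
    gcongr
    exact q.norm_coe_le_norm _
  refine eq_of_forall_test (u := fun f => ι e f) (w := fun f => ∫ x, w x * f x)
    (ι e).continuous ?_ (fun φ => h.2 φ) f
  exact (T' ∘L SchwartzMap.toBoundedContinuousFunctionCLM ℂ (Eucl n) ℂ).continuous

/-! ### Multiplication of periodic functions by a Schwartz function -/

variable {b : Module.Basis (Fin n) ℝ (Eucl n)}

theorem locallyIntegrable_schwartz_mul (ψ : 𝓢(Eucl n, ℂ)) {w : Eucl n → ℂ}
    (hw : LocallyIntegrable w volume) : LocallyIntegrable (fun x => ψ x * w x) volume :=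
  hw.of_norm_le (ψ.continuous.aestronglyMeasurable.mul hw.aestronglyMeasurable)
    (ae_of_all _ fun x => by rw [norm_mul]; gcongr; exact ψ.norm_le_seminorm ℝ x)

/-- On μ + I the function ψw is at most a(μ) times a translate of w 1_I. The pieces therefore have
norms summable in μ and their series converges in the complete space E. -/
theorem exists_rep_schwartz_mul [CompleteSpace E] (hs : IsSolid ι) {C : ℝ} {p : ℕ} (hC : 0 ≤ C)
    (ht : TranslationBound ι C p) (ψ : 𝓢(Eucl n, ℂ)) :
    ∃ K, 0 ≤ K ∧ ∀ (w : Eucl n → ℂ) (e : E), LocallyIntegrable w volume → AEPeriodic b w →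
      RepFun ι e ((ZSpan.fundamentalDomain b).indicator w) →
      ∃ e', RepFun ι e' (fun x => ψ x * w x) ∧ ‖e'‖ ≤ K * ‖e‖ := by
  obtain ⟨R, -, hR⟩ := exists_norm_le_fundamentalDomain b
  obtain ⟨a, ha0, ha, hab⟩ := exists_summable_bound (Submodule.span ℤ (Set.range b)) ψ R p
  refine ⟨∑' μ : Submodule.span ℤ (Set.range b), C * ((1 + ‖(μ : Eucl n)‖) ^ p * a μ),
    tsum_nonneg fun μ => by have := ha0 μ; positivity, fun w e hw hp h => ?_⟩
  have hψw := locallyIntegrable_schwartz_mul ψ hw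
  have hmem : ∀ (μ : Submodule.span ℤ (Set.range b)) (x : Eucl n),
      x ∈ μ +ᵥ ZSpan.fundamentalDomain b ↔ x + -(μ : Eucl n) ∈ ZSpan.fundamentalDomain b :=
    fun μ x => by
      rw [Set.mem_vadd_set_iff_neg_vadd_mem, add_comm]
      rfl
  have hmeas : ∀ μ : Submodule.span ℤ (Set.range b),
      MeasurableSet (μ +ᵥ ZSpan.fundamentalDomain b) := fun μ =>
    (measurableSet_fundamentalDomain b).const_vadd μ
  have key : ∀ μ : Submodule.span ℤ (Set.range b), ∃ e',
      RepFun ι e' ((μ +ᵥ ZSpan.fundamentalDomain b).indicator fun x => ψ x * w x) ∧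
        ‖e'‖ ≤ C * ((1 + ‖(μ : Eucl n)‖) ^ p * a μ) * ‖e‖ := by
    intro μ
    obtain ⟨e₁, he₁, hn₁⟩ := h.translate ht (-(μ : Eucl n))
    obtain ⟨e', he', hn'⟩ := he₁.solid hs
      (g := (μ +ᵥ ZSpan.fundamentalDomain b).indicator fun x => ψ x * w x)
      (hψw.aestronglyMeasurable.indicator (hmeas μ)) (ha0 μ) (by
        filter_upwards [hp (-μ)] with x hx
        by_cases hxI : x ∈ μ +ᵥ ZSpan.fundamentalDomain b
        · rw [Set.indicator_of_mem hxI, Set.indicator_of_mem ((hmem μ x).1 hxI), norm_mul]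
          have h1 : w (x + -(μ : Eucl n)) = w x := hx
          have h2 := hab μ (x + -(μ : Eucl n)) (hR _ ((hmem μ x).1 hxI))
          rw [neg_add_cancel_right] at h2
          rw [h1]
          gcongr
        · rw [Set.indicator_of_notMem hxI, norm_zero]
          have := ha0 μ
          positivity)
    refine ⟨e', he', hn'.trans ?_⟩
    rw [norm_neg] at hn₁
    calc a μ * ‖e₁‖ ≤ a μ * (C * (1 + ‖(μ : Eucl n)‖) ^ p * ‖e‖) := by
          have := ha0 μ
          gcongr
      _ = _ := by ring
  choose ε hε hεn using key
  have hsum : Summable fun μ : Submodule.span ℤ (Set.range b) =>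
      C * ((1 + ‖(μ : Eucl n)‖) ^ p * a μ) * ‖e‖ := (ha.mul_left C).mul_right _
  have hεs : Summable ε := hsum.of_norm_bounded hεn
  refine ⟨∑' μ, ε μ, ⟨hψw, fun φ => ?_⟩, ?_⟩
  -- Evaluation at φ is continuous on E, so the sum of the series is identified with ψw by testing
  -- term by term.
  · let L : E →L[ℂ] ℂ := (PointwiseConvergenceCLM.evalCLM (RingHom.id ℂ) ℂ φ.toSchwartz) ∘L ι
    have h1 : L (∑' μ, ε μ) = ∑' μ, L (ε μ) := L.map_tsum hεs
    change L (∑' μ, ε μ) = _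
    rw [h1, ofFun, (ZSpan.isAddFundamentalDomain b volume).integral_eq_tsum _
      (integrable_mul_test hψw φ)]
    refine tsum_congr fun μ => ?_
    change ι (ε μ) φ.toSchwartz = _
    rw [(hε μ).2 φ, ofFun, ← integral_indicator (hmeas μ)]
    congr 1
    ext x
    by_cases hx : x ∈ μ +ᵥ ZSpan.fundamentalDomain b <;> simp [hx]
  · refine (tsum_of_norm_bounded hsum.hasSum hεn).trans (le_of_eq ?_)
    rw [tsum_mul_right]

end Spaces

/-! ### Periodic extension -/

section Extension

variable {b : Module.Basis (Fin n) ℝ (Eucl n)}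

variable (b) in
-- On bounded sets reduction modulo the lattice is one of finitely many translations, which makes
-- periodic extension a local matter.
theorem exists_finset_neg_floor_mem (R : ℝ) :
    ∃ T : Finset (Eucl n), ∀ x, ‖x‖ ≤ R → -(ZSpan.floor b x : Eucl n) ∈ T := by
  obtain ⟨R', -, hR'⟩ := exists_norm_le_fundamentalDomain b
  have hfin : Set.Finite (Metric.closedBall (0 : Eucl n) (R + R') ∩
      (Submodule.span ℤ (Set.range b) : Set (Eucl n))) :=
    ZSpan.setFinite_inter b Metric.isBounded_closedBall
  refine ⟨hfin.toFinset, fun x hx => ?_⟩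
  rw [Set.Finite.mem_toFinset]
  refine ⟨?_, neg_mem (ZSpan.floor b x).2⟩
  rw [mem_closedBall_zero_iff, norm_neg]
  have h1 := hR' _ (ZSpan.fract_mem_fundamentalDomain b x)
  have h2 : (ZSpan.floor b x : Eucl n) = x - ZSpan.fract b x := by simp [ZSpan.fract_apply]
  rw [h2]
  exact (norm_sub_le _ _).trans (add_le_add hx h1)

theorem fract_eq_add (x : Eucl n) : ZSpan.fract b x = x + -(ZSpan.floor b x : Eucl n) := by
  rw [ZSpan.fract_apply, sub_eq_add_neg]

theorem AEPeriodic.ae_fract {w : Eucl n → ℂ} (hp : AEPeriodic b w) :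
    ∀ᵐ x, w (ZSpan.fract b x) = w x := by
  filter_upwards [ae_all_iff.2 hp] with x hx
  rw [fract_eq_add]
  exact hx (-(ZSpan.floor b x))

theorem aePeriodic_comp_fract (w : Eucl n → ℂ) : AEPeriodic b fun x => w (ZSpan.fract b x) :=
  fun μ => ae_of_all _ fun x => by
    beta_reduce
    rw [ZSpan.fract_add_ZSpan b x μ.2]

theorem locallyIntegrable_comp_fract {w : Eucl n → ℂ} (hw : LocallyIntegrable w volume) :
    LocallyIntegrable (fun x => w (ZSpan.fract b x)) volume := by
  rw [locallyIntegrable_iff]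
  intro K hK
  obtain ⟨R, hR⟩ := hK.isBounded.exists_norm_le
  obtain ⟨T, hT⟩ := exists_finset_neg_floor_mem b R
  have hcov : K ⊆ ⋃ ν ∈ (T : Set (Eucl n)), {x | x + ν ∈ ZSpan.fundamentalDomain b ∧
      ZSpan.fract b x = x + ν} := fun x hx => by
    refine mem_iUnion₂.2 ⟨_, hT x (hR x hx), ?_, fract_eq_add x⟩
    rw [← fract_eq_add]
    exact ZSpan.fract_mem_fundamentalDomain b x
  refine IntegrableOn.mono_set ?_ hcov
  rw [integrableOn_finite_biUnion T.finite_toSet]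
  intro ν _
  -- T may contain vectors outside the lattice; their pieces are empty.
  by_cases hν : ν ∈ Submodule.span ℤ (Set.range b)
  · have hset : {x | x + ν ∈ ZSpan.fundamentalDomain b ∧ ZSpan.fract b x = x + ν} =
        (fun x => x + ν) ⁻¹' ZSpan.fundamentalDomain b := by
      ext x
      refine ⟨fun h => h.1, fun h => ⟨h, ?_⟩⟩
      rw [← ZSpan.fract_add_ZSpan b x hν]
      exact ZSpan.fract_eq_self.2 h
    rw [hset]
    have hm : MeasurableSet ((fun x => x + ν) ⁻¹' ZSpan.fundamentalDomain b) :=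
      (measurableSet_fundamentalDomain b).preimage (measurable_add_const ν)
    have h1 : IntegrableOn (fun x => w (x + ν)) ((fun x => x + ν) ⁻¹' ZSpan.fundamentalDomain b) :=
      ((measurePreserving_add_right volume ν).integrableOn_comp_preimage
        (MeasurableEquiv.addRight ν).measurableEmbedding).2 (integrableOn_fundamentalDomain hw)
    refine h1.congr_fun (fun x hx => ?_) hm
    beta_reduce
    rw [← ZSpan.fract_add_ZSpan b x hν, ZSpan.fract_eq_self.2 hx]
  · have hset : {x | x + ν ∈ ZSpan.fundamentalDomain b ∧ ZSpan.fract b x = x + ν} = ∅ := by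
      ext x
      simp only [mem_ofPred_eq, mem_empty_iff_false, iff_false, not_and]
      intro _ h
      apply hν
      have : ν = -(ZSpan.floor b x : Eucl n) := by
        rw [fract_eq_add] at h
        exact (add_left_cancel h).symm
      rw [this]
      exact neg_mem (ZSpan.floor b x).2
    rw [hset]
    exact integrableOn_empty

end Extension

section Spaces

variable {E : Type u} [NormedAddCommGroup E] [NormedSpace ℂ E] {ι : E →L[ℂ] Temp n}
  {Λ : Submodule ℤ (Eucl n)} {b : Module.Basis (Fin n) ℝ (Eucl n)}

/-- Periodic functions with `f 1_I ∈ E` belong to `E_loc`. -/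
theorem exists_rep_mul_test (hs : IsSolid ι) {C : ℝ} {p : ℕ} (hC : 0 ≤ C)
    (ht : TranslationBound ι C p) {w : Eucl n → ℂ} {e : E} (hw : LocallyIntegrable w volume)
    (hp : AEPeriodic b w) (h : RepFun ι e ((ZSpan.fundamentalDomain b).indicator w)) (φ : Test n) :
    ∃ e', RepFun ι e' (fun x => φ x * w x) := by
  have hφ : ∀ x, ‖φ x‖ ≤ SchwartzMap.seminorm ℝ 0 0 φ.toSchwartz := φ.toSchwartz.norm_le_seminorm ℝ
  obtain ⟨R, hR⟩ := (IsCompact.isBounded φ.hasCompactSupport).exists_norm_le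
  obtain ⟨T, hT⟩ := exists_finset_neg_floor_mem b R
  obtain ⟨K', -, hK'⟩ := exists_rep_of_le_sum_translates hs hC ht T
    (K := SchwartzMap.seminorm ℝ 0 0 φ.toSchwartz) (by positivity)
  obtain ⟨e', he', -⟩ := hK' e _ (fun x => φ x * w x) h
    (φ.continuous.aestronglyMeasurable.mul hw.aestronglyMeasurable) (by
      filter_upwards [hp.ae_fract] with x hx
      rw [norm_mul]
      by_cases hx0 : φ x = 0
      · rw [hx0, norm_zero, zero_mul]
        positivity
      · have hxT := hT x (hR x (subset_tsupport _ hx0))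
        gcongr
        · exact hφ x
        · refine le_trans (le_of_eq ?_) (Finset.single_le_sum (f := fun μ =>
            ‖(ZSpan.fundamentalDomain b).indicator w (x + μ)‖) (fun _ _ => norm_nonneg _) hxT)
          beta_reduce
          rw [← fract_eq_add, Set.indicator_of_mem (ZSpan.fract_mem_fundamentalDomain b x), hx])
  exact ⟨e', he'⟩

/-! ### Recovering a periodic function from its product with the window -/

variable {U : Opens (Eucl n)} {χ : 𝓓(U, ℂ)}

/-- On I one has δ|w(x)| ≤ ∑ |ψ(x + μ)|² |w(x)| ≤ B ∑ |(ψw)(x + μ)|, with B = sup |ψ| and w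
periodic. This is the lower bound, with constant B/δ before translation norms. -/
theorem exists_rep_indicator (hs : IsSolid ι) {C : ℝ} {p : ℕ} (hC : 0 ≤ C)
    (ht : TranslationBound ι C p) {ψ : 𝓢(Eucl n, ℂ)} {F : Finset (Submodule.span ℤ (Set.range b))}
    {δ : ℝ} (hδ : 0 < δ)
    (hF : ∀ x ∈ ZSpan.fundamentalDomain b, δ ≤ ∑ μ ∈ F, ‖ψ (x + μ)‖ ^ 2) :
    ∃ K, 0 ≤ K ∧ ∀ (w : Eucl n → ℂ) (e : E), LocallyIntegrable w volume → AEPeriodic b w →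
      RepFun ι e (fun x => ψ x * w x) →
      ∃ e', RepFun ι e' ((ZSpan.fundamentalDomain b).indicator w) ∧ ‖e'‖ ≤ K * ‖e‖ := by
  set B := SchwartzMap.seminorm ℝ 0 0 ψ with hB
  have hψ : ∀ x, ‖ψ x‖ ≤ B := ψ.norm_le_seminorm ℝ
  have hB0 : 0 ≤ B := by positivity
  obtain ⟨K, hK0, hK⟩ := exists_rep_of_le_sum_translates hs hC ht
    (F.map ⟨_, Subtype.val_injective⟩) (K := B / δ) (by positivity)
  refine ⟨K, hK0, fun w e hw hp h => hK e _ _ h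
    (hw.aestronglyMeasurable.indicator (measurableSet_fundamentalDomain b)) ?_⟩
  filter_upwards [ae_all_iff.2 hp] with x hx
  by_cases hxI : x ∈ ZSpan.fundamentalDomain b
  · rw [Set.indicator_of_mem hxI, Finset.sum_map]
    simp only [Function.Embedding.coeFn_mk, hx, norm_mul]
    rw [div_mul_eq_mul_div, le_div_iff₀ hδ]
    calc ‖w x‖ * δ ≤ ‖w x‖ * ∑ μ ∈ F, ‖ψ (x + μ)‖ ^ 2 := by gcongr; exact hF x hxI
      _ = ∑ μ ∈ F, ‖ψ (x + μ)‖ * (‖ψ (x + μ)‖ * ‖w x‖) := by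
          rw [Finset.mul_sum]; exact Finset.sum_congr rfl fun μ _ => by ring
      _ ≤ ∑ μ ∈ F, B * (‖ψ (x + μ)‖ * ‖w x‖) := by gcongr; exact hψ _
      _ = _ := by rw [Finset.mul_sum]
  · rw [Set.indicator_of_notMem hxI, norm_zero]
    positivity

theorem schwartzMod_schwartzMod_neg (ξ : Eucl n) (f : 𝓢(Eucl n, ℂ)) :
    schwartzMod ξ (schwartzMod (-ξ) f) = f := by
  ext t
  rw [schwartzMod_apply, schwartzMod_apply, ← mul_assoc, ← character_add_left]
  simp

/-- The inverse Fourier transform of `S_χ(c)` divided by `ψ = 𝓕⁻¹ χ` is periodic. -/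
theorem ae_mul_fourier_reflect_eq {c : Λ → ℂ} {e : E} {g : Eucl n → ℂ} (hg : RepFun ι e g)
    (he : Represents (fourierSpace ι) e (synthesis 0 Λ χ c)) {μ : Eucl n} (hμ : μ ∈ dualLattice Λ) :
    ∀ᵐ x, g (x + μ) * 𝓕 (reflect χ) x = g x * 𝓕 (reflect χ) (x + μ) := by
  have he' : ∀ (k : 𝓢(Eucl n, ℂ)) (_ : HasCompactSupport k),
      ι e (𝓕 k) = ∑ᶠ l : Λ, c l * conv (reflect χ) k (l : Eucl n) := fun k hk => by
    have := he (Test.ofSchwartz k hk)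
    rw [synthesis_zero_eq, Test.ofSchwartz_toSchwartz] at this
    exact this
  set ψ := 𝓕 (reflect χ) with hψ
  set ψ' := 𝓕 (schwartzMod (-μ) (reflect χ)) with hψ'
  have hψ'a : ∀ x, ψ' x = ψ (x + μ) := fun x => by
    rw [hψ', fourier_schwartzMod, sub_neg_eq_add]
  -- Pairing g with Af and Bf yields the two sides of the claim tested against f: Af = ψ(· + μ) f,
  -- while Bf is ψf translated by μ.
  let A : 𝓢(Eucl n, ℂ) →L[ℂ] 𝓢(Eucl n, ℂ) := SchwartzMap.smulLeftCLM ℂ ψ'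
  let B : 𝓢(Eucl n, ℂ) →L[ℂ] 𝓢(Eucl n, ℂ) :=
    SchwartzMap.compSubConstCLM ℂ μ ∘L SchwartzMap.smulLeftCLM ℂ ψ
  have hA : ∀ f x, A f x = ψ' x * f x := fun f x =>
    SchwartzMap.smulLeftCLM_apply_apply ψ'.hasTemperateGrowth f x
  have hB : ∀ f x, B f x = ψ (x - μ) * f (x - μ) := fun f x =>
    SchwartzMap.smulLeftCLM_apply_apply ψ.hasTemperateGrowth f (x - μ)
  have hχc := hasCompactSupport_reflect χ
  have h1 : ∀ φ : Test n, ι e (A (𝓕 φ.toSchwartz)) = ι e (B (𝓕 φ.toSchwartz)) := by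
    intro φ
    have hφ : HasCompactSupport φ.toSchwartz := φ.hasCompactSupport
    have hA1 : A (𝓕 φ.toSchwartz) = 𝓕 (conv (schwartzMod (-μ) (reflect χ)) φ.toSchwartz) := by
      ext x
      rw [hA, fourier_conv_apply]
    have hB1 : B (𝓕 φ.toSchwartz) = 𝓕 (schwartzMod μ (conv (reflect χ) φ.toSchwartz)) := by
      ext x
      rw [hB, fourier_schwartzMod, fourier_conv_apply]
    rw [hA1, hB1, he' _ (hasCompactSupport_conv (hasCompactSupport_schwartzMod _ hχc) hφ),
      he' _ (hasCompactSupport_schwartzMod _ (hasCompactSupport_conv hχc hφ))]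
    refine finsum_congr fun l => ?_
    -- The two convolutions to be sampled differ by the modulation M_μ, whose character equals 1 at
    -- every point of Λ.
    have h2 : conv (reflect χ) (schwartzMod μ (conv (reflect χ) φ.toSchwartz)) =
        schwartzMod μ (conv (reflect χ) (conv (schwartzMod (-μ) (reflect χ)) φ.toSchwartz)) := by
      rw [conv_left_comm (reflect χ) (schwartzMod (-μ) (reflect χ)),
        schwartzMod_conv μ (schwartzMod (-μ) (reflect χ)), schwartzMod_schwartzMod_neg]
    rw [h2, schwartzMod_apply, character_comm, character_eq_one_of_mem l.2 hμ, one_mul]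
  have h2 : ∀ f, ι e (A f) = ι e (B f) := fun f => by
    have h3 := eq_of_forall_test (u := fun f => ι e (A (𝓕 f))) (w := fun f => ι e (B (𝓕 f)))
      ((ι e).continuous.comp (A.continuous.comp (FourierTransform.fourierCLM ℂ 𝓢(Eucl n, ℂ)).continuous))
      ((ι e).continuous.comp (B.continuous.comp (FourierTransform.fourierCLM ℂ 𝓢(Eucl n, ℂ)).continuous))
      h1 (𝓕⁻ f)
    simpa using h3
  refine ae_eq_of_ofFun_eq ?_ ?_ fun η => ?_
  · have := locallyIntegrable_schwartz_mul ψ (hg.1.comp_add_const μ)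
    simpa only [mul_comm] using this
  · have := locallyIntegrable_schwartz_mul ψ' hg.1
    simpa only [mul_comm, hψ'a] using this
  · have hA2 : A η.toSchwartz = (Test.mk' (fun x => ψ' x * η x) ((ψ'.smooth ⊤).mul η.contDiff)
        η.hasCompactSupport.mul_left).toSchwartz := by
      ext x; rw [hA]; rfl
    have hB2 : B η.toSchwartz = ((Test.mk' (fun x => ψ x * η x) ((ψ.smooth ⊤).mul η.contDiff)
        η.hasCompactSupport.mul_left).shift (-μ)).toSchwartz := by
      ext x; rw [hB, sub_eq_add_neg]; rfl
    have h4 := h2 η.toSchwartz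
    rw [hA2, hB2, hg.2, hg.2, ofFun, ofFun] at h4
    rw [← integral_add_right_eq_self (fun t => g t * (Test.shift (-μ) _) t) μ] at h4
    simp only [Test.shift_apply, Test.mk'_apply, add_neg_cancel_right, hψ'a] at h4
    simp only [ofFun, mul_assoc]
    exact h4.symm

/-- A direct quotient g/ψ fails at zeros of ψ. The average ∑ conj ψ(x + μ) g(x + μ) / ∑ |ψ(x + μ)|²
over F has denominator at least δ on I, is dominated by translates of g, and is extended
periodically from I. -/
theorem exists_periodic_of_synthesis (hs : IsSolid ι) {C : ℝ} {p : ℕ} (hC : 0 ≤ C)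
    (ht : TranslationBound ι C p) (hb : Submodule.span ℤ (Set.range b) = dualLattice Λ)
    {F : Finset (Submodule.span ℤ (Set.range b))} {δ : ℝ} (hδ : 0 < δ)
    (hF : ∀ x ∈ ZSpan.fundamentalDomain b, δ ≤ ∑ μ ∈ F, ‖𝓕 (reflect χ) (x + μ)‖ ^ 2)
    {c : Λ → ℂ} {e : E} (he : Represents (fourierSpace ι) e (synthesis 0 Λ χ c)) :
    ∃ w, LocallyIntegrable w volume ∧ AEPeriodic b w ∧ RepFun ι e (fun x => 𝓕 (reflect χ) x * w x) ∧
      ∃ e₀, RepFun ι e₀ ((ZSpan.fundamentalDomain b).indicator w) := by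
  obtain ⟨g, hg⟩ := hs.locallyIntegrable e
  set ψ := 𝓕 (reflect χ) with hψ
  set B := SchwartzMap.seminorm ℝ 0 0 ψ with hB
  have hψB : ∀ x, ‖ψ x‖ ≤ B := ψ.norm_le_seminorm ℝ
  have hB0 : 0 ≤ B := by positivity
  let D : Eucl n → ℝ := fun x => ∑ μ ∈ F, ‖ψ (x + μ)‖ ^ 2
  let w₀ : Eucl n → ℂ := (ZSpan.fundamentalDomain b).indicator fun x =>
    (∑ μ ∈ F, (starRingEnd ℂ) (ψ (x + μ)) * g (x + μ)) / (D x : ℂ)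
  have hψc : ∀ μ : Eucl n, Continuous fun x => ψ (x + μ) := fun μ =>
    ψ.continuous.comp (continuous_add_const μ)
  have hDc : Continuous D := continuous_finsetSum _ fun μ _ => (hψc μ).norm.pow 2
  have hw₀m : AEStronglyMeasurable w₀ volume := by
    refine AEStronglyMeasurable.indicator ?_ (measurableSet_fundamentalDomain b)
    refine AEStronglyMeasurable.div₀ ?_ (Complex.continuous_ofReal.comp hDc).aestronglyMeasurable
    refine Finset.aestronglyMeasurable_fun_sum _ fun μ _ => ?_
    exact (Complex.continuous_conj.comp (hψc μ)).aestronglyMeasurable.mul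
      (hg.1.comp_add_const (μ : Eucl n)).aestronglyMeasurable
  obtain ⟨K, -, hK⟩ := exists_rep_of_le_sum_translates hs hC ht
    (F.map ⟨_, Subtype.val_injective⟩) (K := B / δ) (by positivity)
  obtain ⟨e₀, he₀, -⟩ := hK e g w₀ hg hw₀m (ae_of_all _ fun x => by
    by_cases hxI : x ∈ ZSpan.fundamentalDomain b
    · have hDx : δ ≤ D x := hF x hxI
      simp only [w₀, Set.indicator_of_mem hxI, Finset.sum_map, Function.Embedding.coeFn_mk]
      rw [norm_div, Complex.norm_real, Real.norm_of_nonneg (hδ.le.trans hDx), div_mul_eq_mul_div]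
      refine div_le_div₀ (by positivity) ?_ hδ hDx
      refine (norm_sum_le _ _).trans ?_
      rw [Finset.mul_sum]
      refine Finset.sum_le_sum fun μ _ => ?_
      rw [norm_mul, RCLike.norm_conj]
      gcongr
      exact hψB _
    · simp only [w₀, Set.indicator_of_notMem hxI, norm_zero]
      positivity)
  refine ⟨fun x => w₀ (ZSpan.fract b x), locallyIntegrable_comp_fract he₀.1,
    aePeriodic_comp_fract w₀, ?_, e₀, ?_⟩
  · refine RepFun.congr hg ?_
    have h1 : ∀ᵐ x, ∀ μ : Submodule.span ℤ (Set.range b), g (x + μ) * ψ x = g x * ψ (x + μ) :=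
      ae_all_iff.2 fun μ => ae_mul_fourier_reflect_eq hg he (hb ▸ μ.2)
    filter_upwards [h1] with x hx
    have hxI := ZSpan.fract_mem_fundamentalDomain b x
    have hDx : (D (ZSpan.fract b x) : ℂ) ≠ 0 :=
      Complex.ofReal_ne_zero.2 (hδ.trans_le (hF _ hxI)).ne'
    simp only [w₀, Set.indicator_of_mem hxI]
    rw [mul_div_assoc', eq_div_iff hDx, Finset.mul_sum]
    simp only [D]
    rw [Complex.ofReal_sum, Finset.mul_sum]
    refine Finset.sum_congr rfl fun μ _ => ?_
    -- The cross relation is used with the lattice vector that moves x to fract x + μ.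
    have h2 := hx (-(ZSpan.floor b x) + μ)
    have h3 : x + ((-(ZSpan.floor b x) + μ : Submodule.span ℤ (Set.range b)) : Eucl n) =
        ZSpan.fract b x + μ := by
      rw [fract_eq_add]; push_cast; abel
    rw [h3] at h2
    rw [← Complex.normSq_eq_norm_sq, ← Complex.mul_conj]
    linear_combination -(starRingEnd ℂ) (ψ (ZSpan.fract b x + μ)) * h2
  · refine he₀.congr (ae_of_all _ fun x => ?_)
    by_cases hxI : x ∈ ZSpan.fundamentalDomain b
    · rw [Set.indicator_of_mem hxI, ZSpan.fract_eq_self.2 hxI]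
    · simp only [w₀, Set.indicator_of_notMem hxI]

/-! ### Synthesis of Fourier coefficients -/

/-- Tested against φ, 𝓕(ψw) is ∫ wψ 𝓕φ, and ψ 𝓕φ is the Fourier transform of the compactly supported
convolution that S_χ samples on Λ. -/
theorem represents_synthesis [DiscreteTopology Λ] [IsZLattice ℝ Λ]
    (hb : Submodule.span ℤ (Set.range b) = dualLattice Λ) {w : Eucl n → ℂ} {e : E}
    (hw : LocallyIntegrable w volume) (hp : AEPeriodic b w)
    (h : RepFun ι e (fun x => 𝓕 (reflect χ) x * w x)) :
    Represents (fourierSpace ι) e (synthesis 0 Λ χ fun l => functionCoefficient b w l) := by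
  intro φ
  have hint : Integrable fun x => 𝓕 (reflect χ) x * w x := by
    simpa only [mul_comm] using hp.integrable_mul_schwartz hw (𝓕 (reflect χ))
  change ι e (𝓕 φ.toSchwartz) = _
  have hφ : HasCompactSupport φ.toSchwartz := φ.hasCompactSupport
  rw [h.apply_of_integrable hint, synthesis_zero_eq, ← hp.integral_mul_fourier hb hw
    (hasCompactSupport_conv (hasCompactSupport_reflect χ) hφ)]
  congr 1
  ext x
  rw [fourier_conv_apply]
  ring

theorem eq_of_represents_fourierSpace {e e' : E} {u : Test n → ℂ}
    (h : Represents (fourierSpace ι) e u) (h' : Represents (fourierSpace ι) e' u) : ι e = ι e' := by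
  have h1 : ∀ φ : Test n, ι e (𝓕 φ.toSchwartz) = ι e' (𝓕 φ.toSchwartz) := fun φ =>
    (h φ).trans (h' φ).symm
  have hF := (FourierTransform.fourierCLM ℂ 𝓢(Eucl n, ℂ)).continuous
  ext f
  have h3 := eq_of_forall_test (u := fun f => ι e (𝓕 f)) (w := fun f => ι e' (𝓕 f))
    ((ι e).continuous.comp hF) ((ι e').continuous.comp hF) h1 (𝓕⁻ f)
  simpa using h3

/-- Testing against the conjugate of T_{l₀}χ isolates c(l₀) ∫ |χ|², since the supports of distinct
translates are disjoint. -/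
theorem synthesis_injective
    (hUd : Pairwise fun l l' : Λ =>
      Disjoint ((fun x => (l : Eucl n) + x) '' (U : Set (Eucl n)))
        ((fun x => (l' : Eucl n) + x) '' (U : Set (Eucl n))))
    (hχ : χ ≠ 0) {c c' : Λ → ℂ} (h : ∀ φ, synthesis 0 Λ χ c φ = synthesis 0 Λ χ c' φ) : c = c' := by
  have hsupp : ∀ t, χ t ≠ 0 → t ∈ U := fun t ht => χ.tsupport_subset (subset_tsupport _ ht)
  have hpos : (∫ t, ‖χ t‖ ^ 2) ≠ 0 := by
    obtain ⟨s, hs⟩ : ∃ s, χ s ≠ 0 := by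
      by_contra! hcon
      exact hχ (by ext s; exact hcon s)
    have hc : Continuous fun t => ‖χ t‖ ^ 2 := χ.continuous.norm.pow 2
    have hcs : HasCompactSupport fun t => ‖χ t‖ ^ 2 :=
      χ.hasCompactSupport.comp_left (g := fun z : ℂ => ‖z‖ ^ 2) (by simp)
    have hs2 : ‖χ s‖ ^ 2 ≠ 0 := pow_ne_zero 2 (norm_ne_zero_iff.2 hs)
    exact (hc.integral_pos_of_hasCompactSupport_nonneg_nonzero hcs
      (fun t => sq_nonneg ‖χ t‖) hs2).ne'
  funext l₀
  obtain ⟨φ, hφa⟩ : ∃ φ : Test n, ∀ t, φ t = (starRingEnd ℂ) (χ (t - l₀)) := ⟨Test.mk' _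
    (Complex.conjCLE.contDiff.comp (χ.contDiff.comp (contDiff_id.sub contDiff_const)))
    ((χ.hasCompactSupport.comp_homeomorph (Homeomorph.subRight (l₀ : Eucl n))).comp_left
      (g := starRingEnd ℂ) (map_zero _)), fun _ => rfl⟩
  have hφ : ∀ l : Λ, l ≠ l₀ → ofFun (twistedTranslation 0 (l : Eucl n) χ) φ = 0 := fun l hl => by
    rw [ofFun, ← integral_zero (Eucl n) ℂ (μ := volume)]
    congr 1
    ext t
    by_cases h1 : χ (t - l) = 0
    · simp [twistedTranslation, h1]
    by_cases h2 : χ (t - l₀) = 0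
    · simp [hφa, h2]
    · exact absurd (show t ∈ (fun x => (l₀ : Eucl n) + x) '' (U : Set (Eucl n)) from
          ⟨t - l₀, hsupp _ h2, by simp⟩)
        (Set.disjoint_left.1 (hUd hl) (show t ∈ _ from ⟨t - l, hsupp _ h1, by simp⟩))
  have hφ₀ : ofFun (twistedTranslation 0 (l₀ : Eucl n) χ) φ ≠ 0 := by
    have : ofFun (twistedTranslation 0 (l₀ : Eucl n) χ) φ = ((∫ t, ‖χ t‖ ^ 2 : ℝ) : ℂ) := by
      rw [ofFun, ← integral_add_right_eq_self _ (l₀ : Eucl n), ← integral_complex_ofReal]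
      congr 1
      ext t
      simp only [twistedTranslation, map_zero, LinearMap.zero_apply, neg_zero,
        character_zero_left, mul_one, hφa, add_sub_cancel_right]
      rw [Complex.mul_conj, Complex.normSq_eq_norm_sq]
    rw [this]
    exact Complex.ofReal_ne_zero.2 hpos
  have h1 : ∀ c : Λ → ℂ, synthesis 0 Λ χ c φ =
      c l₀ * ofFun (twistedTranslation 0 (l₀ : Eucl n) χ) φ := fun c =>
    finsum_eq_single _ l₀ fun l hl => by rw [hφ l hl, mul_zero]
  have h2 := h φ
  rw [h1, h1] at h2
  exact mul_right_cancel₀ hφ₀ h2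

end Spaces

section Main

variable {E : Type u} [NormedAddCommGroup E] [NormedSpace ℂ E] {ι : E →L[ℂ] Temp n}
  {Λ : Submodule ℤ (Eucl n)} {b : Module.Basis (Fin n) ℝ (Eucl n)}

/-! ### Periodic elements of `E_loc` are functions -/

theorem isFunction_density {f : Distr n} (h : ∃ g, IsFunction f g) : IsFunction f (density f) := by
  unfold density
  rw [dif_pos h]
  exact h.choose_spec

theorem density_ae_eq {f : Distr n} {g : Eucl n → ℂ} (h : IsFunction f g) :
    density f =ᵐ[volume] g := by
  have h' := isFunction_density ⟨g, h⟩
  exact ae_eq_of_ofFun_eq h'.1 h.1 fun φ => by rw [← h'.2, ← h.2]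

/-- Each cut-off ρ_N f lies in E, hence is a function by solidity. These functions agree almost
everywhere on common balls and can be glued. -/
theorem exists_isFunction (hs : IsSolid ι) {f : Distr n} (hf : f ∈ PeriodicSpace ι Λ) :
    ∃ g, IsFunction f g := by
  choose ρ hρ _ using fun N : ℕ => exists_test_eq_one (n := n) (N : ℝ)
  have hloc : ∀ N : ℕ, ∃ g, LocallyIntegrable g volume ∧ ∀ φ, f ((ρ N).mul φ) = ofFun g φ := by
    intro N
    obtain ⟨e, he⟩ := hf.1 (ρ N)
    obtain ⟨g, hg, hg'⟩ := hs.locallyIntegrable e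
    exact ⟨g, hg, fun φ => (he φ).symm.trans (hg' φ)⟩
  choose g hg hgf using hloc
  have hmul : ∀ (N : ℕ) (φ : Test n), (∀ t, φ t ≠ 0 → ‖t‖ ≤ N) → (ρ N).mul φ = φ := by
    intro N φ h
    ext t
    by_cases ht : φ t = 0
    · simp [ht]
    · simp [hρ N t (h t ht)]
  have hcons : ∀ᵐ x, ∀ N M : ℕ, ‖x‖ < N → ‖x‖ < M → g N x = g M x := by
    rw [ae_all_iff]; intro N
    rw [ae_all_iff]; intro M
    have := ae_eq_on_ball_of_ofFun_eq (hg N) (hg M) (R := min (N : ℝ) M) fun φ hφ => by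
      have hb : ∀ t, φ t ≠ 0 → ‖t‖ < min (N : ℝ) M := fun t ht => by
        simpa using hφ (subset_tsupport _ ht)
      rw [← hgf, ← hgf, hmul N φ fun t ht => ((hb t ht).trans_le (min_le_left _ _)).le,
        hmul M φ fun t ht => ((hb t ht).trans_le (min_le_right _ _)).le]
    filter_upwards [this] with x hx hN hM
    exact hx (by simpa using ⟨hN, hM⟩)
  -- The index is a natural number strictly above ‖x‖, so the cut-off equals 1 around x.
  let G : Eucl n → ℂ := fun x => g (⌊‖x‖⌋₊ + 1) x
  have hG : ∀ᵐ x, ∀ N : ℕ, ‖x‖ < N → G x = g N x := by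
    filter_upwards [hcons] with x hx N hN
    exact hx _ _ (by exact_mod_cast Nat.lt_floor_add_one ‖x‖) hN
  refine ⟨G, ?_, fun φ => ?_⟩
  · rw [locallyIntegrable_iff]
    intro K hK
    obtain ⟨R, hR⟩ := hK.isBounded.exists_norm_le
    refine ((hg (⌊R⌋₊ + 1)).integrableOn_isCompact hK).congr_fun_ae ?_
    rw [Filter.EventuallyEq, ae_restrict_iff' hK.measurableSet]
    filter_upwards [hG] with x hx hxK
    refine (hx _ ((hR x hxK).trans_lt ?_)).symm
    exact_mod_cast Nat.lt_floor_add_one R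
  · obtain ⟨R, hR⟩ := (IsCompact.isBounded φ.hasCompactSupport).exists_norm_le
    have hlt : ∀ t, φ t ≠ 0 → ‖t‖ < (⌊R⌋₊ + 1 : ℕ) := fun t ht =>
      (hR t (subset_tsupport _ ht)).trans_lt (by exact_mod_cast Nat.lt_floor_add_one R)
    rw [← hmul (⌊R⌋₊ + 1) φ fun t ht => (hlt t ht).le, hgf,
      hmul (⌊R⌋₊ + 1) φ fun t ht => (hlt t ht).le]
    refine integral_congr_ae ?_
    filter_upwards [hG] with x hx
    by_cases h0 : φ x = 0
    · simp [h0]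
    · rw [hx _ (hlt x h0)]

theorem aePeriodic_density (hb : Submodule.span ℤ (Set.range b) = dualLattice Λ) (hs : IsSolid ι)
    {f : Distr n} (hf : f ∈ PeriodicSpace ι Λ) : AEPeriodic b (density f) := by
  have h := isFunction_density (exists_isFunction hs hf)
  intro μ
  refine ae_eq_of_ofFun_eq (h.1.comp_add_const μ) h.1 fun φ => ?_
  have hμ : (μ : Eucl n) ∈ dualLattice Λ := hb ▸ μ.2
  rw [← h.2, ← hf.2 _ (neg_mem hμ), h.2, ofFun, ofFun,
    ← integral_add_right_eq_self (fun t => density f t * _) (μ : Eucl n)]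
  simp

theorem exists_rep_indicator_density (hs : IsSolid ι) {f : Distr n} (hf : f ∈ PeriodicSpace ι Λ) :
    ∃ e, RepFun ι e ((ZSpan.fundamentalDomain b).indicator (density f)) := by
  have h := isFunction_density (exists_isFunction hs hf)
  obtain ⟨R, -, hR⟩ := exists_norm_le_fundamentalDomain b
  obtain ⟨ρ, hρ, -⟩ := exists_test_eq_one (n := n) R
  obtain ⟨e, he⟩ := hf.1 ρ
  have hrep : RepFun ι e (fun x => ρ x * density f x) := by
    refine ⟨locallyIntegrable_schwartz_mul ρ.toSchwartz h.1, fun φ => ?_⟩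
    rw [he φ]
    beta_reduce
    rw [h.2]
    simp only [ofFun, Test.mul_apply]
    congr 1
    ext x
    ring
  obtain ⟨e', he', -⟩ := hrep.solid hs
    (h.1.aestronglyMeasurable.indicator (measurableSet_fundamentalDomain b)) zero_le_one
    (ae_of_all _ fun x => by
      by_cases hx : x ∈ ZSpan.fundamentalDomain b
      · simp [hx, hρ x (hR x hx)]
      · rw [Set.indicator_of_notMem hx, norm_zero]
        positivity)
  exact ⟨e', he'⟩

/-! ### Norms -/

/-- K + 1 replaces K so that the factor is nonzero and division in `ℝ≥0∞` is legitimate, including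
when a norm is infinite. -/
theorem normIn_le_mul {ι' : E →L[ℂ] Temp n} {u u' : Test n → ℂ} {K : ℝ} (hK : 0 ≤ K)
    (h : ∀ e, Represents ι' e u' → ∃ e', Represents ι e' u ∧ ‖e'‖ ≤ K * ‖e‖) :
    normIn ι u ≤ (K + 1).toNNReal * normIn ι' u' := by
  have hK1 : ((K + 1).toNNReal : ℝ≥0∞) ≠ 0 := by
    simp only [ne_eq, ENNReal.coe_eq_zero, Real.toNNReal_eq_zero, not_le]
    linarith
  rw [mul_comm, ← ENNReal.div_le_iff hK1 ENNReal.coe_ne_top]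
  refine le_iInf₂ fun e he => ?_
  rw [ENNReal.div_le_iff hK1 ENNReal.coe_ne_top]
  obtain ⟨e', he', hn⟩ := h e he
  refine (iInf₂_le e' he').trans ?_
  rw [← ofReal_norm, ← ofReal_norm, ENNReal.ofNNReal_toNNReal,
    ← ENNReal.ofReal_mul (norm_nonneg _)]
  refine ENNReal.ofReal_le_ofReal ?_
  nlinarith [norm_nonneg e]

/-! ### Fourier coefficients -/

theorem functionCoefficient_congr {f g : Eucl n → ℂ} (h : f =ᵐ[volume] g) (l : Eucl n) :
    functionCoefficient b f l = functionCoefficient b g l := by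
  unfold functionCoefficient
  congr 1
  refine integral_congr_ae (ae_restrict_of_ae ?_)
  filter_upwards [h] with x hx
  rw [hx]

theorem integrableOn_mul_character {w : Eucl n → ℂ} (hw : LocallyIntegrable w volume) (l : Eucl n) :
    IntegrableOn (fun x => w x * character l x) (ZSpan.fundamentalDomain b) :=
  (integrableOn_fundamentalDomain hw).mul_bdd (c := 1)
    (continuous_character l).aestronglyMeasurable (ae_of_all _ fun x => (norm_character l x).le)

variable (b) in
/-- The Fourier coefficients as a linear map on `E(ℝⁿ/Λ^⊥)`. -/
def coefficientMap (hs : IsSolid ι) : PeriodicSpace ι Λ →ₗ[ℂ] (Λ → ℂ) where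
  toFun f l := fourierCoefficient b f l
  map_add' := fun f g => by
    have hf := isFunction_density (exists_isFunction hs f.2)
    have hg := isFunction_density (exists_isFunction hs g.2)
    have h : density ((f + g : PeriodicSpace ι Λ) : Distr n) =ᵐ[volume]
        fun x => density f x + density g x := by
      refine density_ae_eq ⟨hf.1.add hg.1, fun φ => ?_⟩
      rw [ofFun, Submodule.coe_add]
      simp only [add_mul]
      rw [integral_add (integrable_mul_test hf.1 φ) (integrable_mul_test hg.1 φ)]
      exact congrArg₂ (· + ·) (hf.2 φ) (hg.2 φ)
    funext l
    change functionCoefficient b _ l = functionCoefficient b _ l + functionCoefficient b _ l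
    rw [functionCoefficient_congr h, functionCoefficient, functionCoefficient, functionCoefficient,
      ← mul_add, ← integral_add (integrableOn_mul_character hf.1 _)
        (integrableOn_mul_character hg.1 _)]
    simp only [add_mul]
  map_smul' := fun a f => by
    have hf := isFunction_density (exists_isFunction hs f.2)
    have h : density ((a • f : PeriodicSpace ι Λ) : Distr n) =ᵐ[volume]
        fun x => a * density f x := by
      refine density_ae_eq ⟨hf.1.smul a, fun φ => ?_⟩
      rw [ofFun, Submodule.coe_smul]
      simp only [mul_assoc]
      rw [integral_const_mul]
      exact congrArg (a * ·) (hf.2 φ)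
    funext l
    change functionCoefficient b _ l = a * functionCoefficient b _ l
    rw [functionCoefficient_congr h, functionCoefficient, functionCoefficient]
    simp only [mul_assoc]
    rw [integral_const_mul]
    ring

theorem exists_mem_periodicSpace (hs : IsSolid ι) {C : ℝ} {p : ℕ} (hC : 0 ≤ C)
    (ht : TranslationBound ι C p) (hb : Submodule.span ℤ (Set.range b) = dualLattice Λ)
    {w : Eucl n → ℂ} {e : E} (hw : LocallyIntegrable w volume)
    (hp : AEPeriodic b w) (h : RepFun ι e ((ZSpan.fundamentalDomain b).indicator w)) :
    ∃ f ∈ PeriodicSpace ι Λ, IsFunction f w := by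
  let f : Distr n := TestFunction.integralAgainstBilinCLM (ContinuousLinearMap.mul ℂ ℂ) volume w
  have hf : ∀ φ, f φ = ofFun w φ := fun φ => by
    rw [TestFunction.integralAgainstBilinCLM_eq_integral (hw.locallyIntegrableOn _), ofFun]
    simp only [ContinuousLinearMap.mul_apply', mul_comm]
  refine ⟨f, ⟨fun χ => ?_, fun μ hμ φ => ?_⟩, hw, hf⟩
  · obtain ⟨e', he'⟩ := exists_rep_mul_test hs hC ht hw hp h χ
    refine ⟨e', fun φ => ?_⟩
    rw [he'.2 φ]
    beta_reduce
    rw [hf]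
    simp only [ofFun, Test.mul_apply]
    congr 1
    ext x
    ring
  · rw [hf, hf, ofFun, ofFun, ← integral_add_right_eq_self (fun t => w t * φ t) μ]
    refine integral_congr_ae ?_
    have hμ' : μ ∈ Submodule.span ℤ (Set.range b) := hb ▸ hμ
    filter_upwards [hp ⟨μ, hμ'⟩] with x hx
    rw [Test.shift_apply]
    have : w (x + μ) = w x := hx
    rw [this]

/-- The lattice is countable, so for almost every x the product vanishes on all of x + Λ^⊥. There w
is constant and ψ is somewhere nonzero. -/
theorem ae_eq_zero_of_fourier_reflect_mul [DiscreteTopology Λ] [IsZLattice ℝ Λ]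
    (hb : Submodule.span ℤ (Set.range b) = dualLattice Λ) {U : Opens (Eucl n)}
    (hUd : Pairwise fun l l' : Λ =>
      Disjoint ((fun x => (l : Eucl n) + x) '' (U : Set (Eucl n)))
        ((fun x => (l' : Eucl n) + x) '' (U : Set (Eucl n))))
    {χ : 𝓓(U, ℂ)} (hχ : χ ≠ 0) {w : Eucl n → ℂ} (hp : AEPeriodic b w)
    (h : (fun x => 𝓕 (reflect χ) x * w x) =ᵐ[volume] 0) : w =ᵐ[volume] 0 := by
  have h1 : ∀ᵐ x, ∀ μ : Submodule.span ℤ (Set.range b),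
      𝓕 (reflect χ) (x + (μ : Eucl n)) * w (x + (μ : Eucl n)) = 0 := by
    rw [ae_all_iff]
    intro μ
    exact (measurePreserving_add_right volume (μ : Eucl n)).quasiMeasurePreserving.ae h
  filter_upwards [h1, ae_all_iff.2 hp] with x hx hpx
  obtain ⟨μ, hμ⟩ := exists_fourier_reflect_ne_zero hb hUd hχ x
  have := hx μ
  rw [hpx μ] at this
  exact (mul_eq_zero.1 this).resolve_left hμ

end Main

end DistSpace

end

/-! ### The isomorphism and the two norm estimates -/

theorem proposition5p10 {n : ℕ} {E : Type u} [NormedAddCommGroup E] [NormedSpace ℂ E]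
    [CompleteSpace E] (ι : E →L[ℂ] Temp n)
    (hE : IsTMIB ι ∨ IsDTMIB.{u, v} ι) (hsolid : IsSolid ι)
    (Λ : Submodule ℤ (Eucl n)) [DiscreteTopology Λ] [IsZLattice ℝ Λ]
    (b : Module.Basis (Fin n) ℝ (Eucl n))
    (hb : Submodule.span ℤ (Set.range b) = dualLattice Λ)
    (U : Opens (Eucl n)) (hU0 : 0 ∈ U)
    (hUb : Bornology.IsBounded (U : Set (Eucl n)))
    (hUd : Pairwise fun l l' : Λ =>
      Disjoint ((fun x => (l : Eucl n) + x) '' (U : Set (Eucl n)))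
        ((fun x => (l' : Eucl n) + x) '' (U : Set (Eucl n))))
    (χ : 𝓓(U, ℂ)) (hχ : χ ≠ 0) :
    (∀ f ∈ PeriodicSpace ι Λ,
      (∃ g, IsFunction f g) ∧ periodicNorm ι b f < ∞) ∧
    ∃ Φ : PeriodicSpace ι Λ ≃ₗ[ℂ]
        DiscreteSpace (fourierSpace ι) 0 Λ χ,
      (∀ (f : PeriodicSpace ι Λ) (l : Λ),
        (Φ f : Λ → ℂ) l = fourierCoefficient b f l) ∧
      ∃ C : ℝ≥0, ∀ f : PeriodicSpace ι Λ,
        discreteNorm (fourierSpace ι) 0 Λ χ (Φ f) ≤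
          C * periodicNorm ι b f ∧
        periodicNorm ι b f ≤
          C * discreteNorm (fourierSpace ι) 0 Λ χ (Φ f) := by
  obtain ⟨C, hC, p, ht⟩ : ∃ C, 0 ≤ C ∧ ∃ p, TranslationBound ι C p :=
    hE.elim (fun h => h.exists_translationBound) (fun h => h.exists_translationBound)
  obtain ⟨F, δ, hδ, hF⟩ := exists_finset_le_sum_norm_sq hb hUd hχ
  obtain ⟨K₁, hK₁, hD₁⟩ := exists_rep_schwartz_mul (b := b) hsolid hC ht
    (FourierTransform.fourier (reflect χ))
  obtain ⟨K₂, hK₂, hD₂⟩ := exists_rep_indicator hsolid hC ht hδ hF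
  have hfun := fun f : PeriodicSpace ι Λ => isFunction_density (exists_isFunction hsolid f.2)
  have hper := fun f : PeriodicSpace ι Λ => aePeriodic_density hb hsolid f.2
  have hind := fun f : PeriodicSpace ι Λ => exists_rep_indicator_density (b := b) hsolid f.2
  have hmul : ∀ f : PeriodicSpace ι Λ, ∃ e,
      RepFun ι e (fun x => FourierTransform.fourier (reflect χ) x * density f x) := fun f => by
    obtain ⟨e₀, he₀⟩ := hind f
    obtain ⟨e, he, -⟩ := hD₁ _ e₀ (hfun f).1 (hper f) he₀
    exact ⟨e, he⟩
  have hsyn : ∀ (f : PeriodicSpace ι Λ) (e : E),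
      RepFun ι e (fun x => FourierTransform.fourier (reflect χ) x * density f x) →
      Represents (fourierSpace ι) e (synthesis 0 Λ χ (coefficientMap b hsolid f)) := fun f e he =>
    represents_synthesis hb (hfun f).1 (hper f) he
  -- Conversely, any e representing the synthesis is ψf: the synthesis determines `ι e`, and one
  -- such element is already known.
  have hrep : ∀ (f : PeriodicSpace ι Λ) (e : E),
      Represents (fourierSpace ι) e (synthesis 0 Λ χ (coefficientMap b hsolid f)) →
      RepFun ι e (fun x => FourierTransform.fourier (reflect χ) x * density f x) := fun f e he => by
    obtain ⟨e', he'⟩ := hmul f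
    refine ⟨he'.1, fun φ => ?_⟩
    rw [eq_of_represents_fourierSpace he (hsyn f e' he')]
    exact he'.2 φ
  let Ψ : PeriodicSpace ι Λ →ₗ[ℂ] DiscreteSpace (fourierSpace ι) 0 Λ χ :=
    (coefficientMap b hsolid).codRestrict _ fun f => by
      obtain ⟨e, he⟩ := hmul f
      exact ⟨e, hsyn f e he⟩
  -- Vanishing coefficients make 0 a representative of ψf, so ψf = 0 and then f = 0.
  have hzero : ∀ f : PeriodicSpace ι Λ, coefficientMap b hsolid f = 0 → f = 0 := by
    intro f hf0
    have h0 : RepFun ι 0 (fun x => FourierTransform.fourier (reflect χ) x * density f x) := by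
      refine hrep f 0 ?_
      rw [hf0]
      intro φ
      simp [synthesis]
    have h1 := ae_eq_of_ofFun_eq h0.1 locallyIntegrable_zero fun φ =>
      (h0.2 φ).symm.trans (RepFun.zero.2 φ)
    have h2 := ae_eq_zero_of_fourier_reflect_mul hb hUd hχ (hper f) h1
    apply Subtype.ext
    ext φ
    rw [(hfun f).2, ofFun_congr h2]
    simp [ofFun]
  have hinj : Function.Injective Ψ := fun f g hfg =>
    LinearMap.ker_eq_bot.1 (LinearMap.ker_eq_bot'.2 hzero) (congrArg Subtype.val hfg)
  have hsurj : Function.Surjective Ψ := by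
    rintro ⟨c, e, he⟩
    obtain ⟨w, hw, hp, hwe, e₀, he₀⟩ := exists_periodic_of_synthesis hsolid hC ht hb hδ hF he
    obtain ⟨f, hf, hfw⟩ := exists_mem_periodicSpace hsolid hC ht hb hw hp he₀
    refine ⟨⟨f, hf⟩, Subtype.ext ?_⟩
    have h1 : coefficientMap b hsolid ⟨f, hf⟩ = fun l : Λ => functionCoefficient b w l :=
      funext fun l => functionCoefficient_congr (density_ae_eq hfw) l
    change coefficientMap b hsolid ⟨f, hf⟩ = c
    rw [h1]
    have h2 := represents_synthesis hb hw hp hwe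
    exact synthesis_injective hUd hχ fun φ => (h2 φ).symm.trans (he φ)
  refine ⟨fun f hf => ⟨exists_isFunction hsolid hf, ?_⟩, LinearEquiv.ofBijective Ψ ⟨hinj, hsurj⟩,
    fun f l => rfl, (max K₁ K₂ + 1).toNNReal, fun f => ⟨?_, ?_⟩⟩
  · obtain ⟨e, he⟩ := hind ⟨f, hf⟩
    exact (iInf₂_le e he.2).trans_lt enorm_lt_top
  · refine normIn_le_mul (hK₁.trans (le_max_left _ _)) fun e he => ?_
    -- The norm is an infimum over all representatives, so the estimate is proved for each e; local
    -- integrability of f 1_I is taken from the known representative.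
    obtain ⟨e', he', hn⟩ := hD₁ _ e (hfun f).1 (hper f)
      ⟨(hind f).choose_spec.1, he⟩
    refine ⟨e', hsyn f e' he', hn.trans ?_⟩
    gcongr
    exact le_max_left _ _
  · refine normIn_le_mul (hK₁.trans (le_max_left _ _)) fun e he => ?_
    obtain ⟨e', he', hn⟩ := hD₂ _ e (hfun f).1 (hper f) (hrep f e he)
    refine ⟨e', he'.2, hn.trans ?_⟩
    gcongr
    exact le_max_right _ _
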